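/- Let $c$ be a positive integer and $\mu,\nu\in\mathbb R$. Write $\mathbb T=\mathbb R/\mathbb Z$ and $e(t)=\exp(2\pi i t)$. Let $\mathbb Z$ act on $\mathbb R\times\mathbb T$ by $\lambda_p(x,y)=(x+2p\mu,\,y+2p\nu)$. Let $D_0=D_0^{c,\nu}$ be the space of all $\Phi\in C(\mathbb R\times\mathbb T\times\mathbb Z)$ with compact support on $\mathbb Z$ such that $$\Phi(x+k,y,p)=e(-ckp(y-p\nu))\,\Phi(x,y,p)\qquad(k,p\in\mathbb Z).$$ With the convolution product and involution of the crossed product $C_0(\mathbb R\times\mathbb T)\rtimes_\lambda\mathbb Z$, $D_0$ is a $*$-subalgebra of the multiplier algebra of this crossed product. The quantum Heisenberg manifold $D^c_{\mu\nu}$ is its norm closure. Let $\tau$ be the trace on $D^c_{\mu\nu}$, that is, the continuous extension of $\Phi\mapsto\int_{\mathbb T^2}\Phi(x,y,0)\,dx\,dy$ ($\Phi\in D_0$), and let $\Pi=\Pi^{\mu\nu}$ be the restriction to $D^c_{\mu\nu}$ of the left regular representation on $L^2(\mathbb R\times\mathbb T\times\mathbb Z)$, so that $$(\Pi_\Phi\xi)(x,y,p)=\sum_{q\in\mathbb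 Z}\Phi(x+2p\mu,y+2p\nu,q)\,\xi(x,y,p-q)\qquad(\Phi\in D_0).$$ Then: 1. For all $k,l\in\mathbb Z$ there is a trace-preserving $*$-isomorphism $D^c_{\mu\nu}\cong D^c_{\mu+k,\nu+l}$. 2. For every $l\in\mathbb Z$ one has $D_0^{c,\nu}\subseteq D_0^{c,\nu+l}$, and the identity map $\Phi\mapsto\Phi$ on these functions extends to a trace-preserving $*$-isomorphism $D^c_{\mu\nu}\to D^c_{\mu,\nu+l}$. 3. There is a trace-preserving $*$-isomorphism $J:D^c_{\mu+1,\nu}\to D^c_{\mu\nu}$ which is given on $\Phi\in D_0$ by $$(J\Phi)(x,y,p)=e\big(c(4p^3\nu/3-p^2y)\big)\,\Phi(x,y,p)\in D_0.$$ Moreover, the operator $$(U\xi)(x,y,p)=e\big(c(-4p^3\nu/3-p^2y)\big)\,\xi(x,y,p)$$ on $L^2(\mathbb R\times\mathbb T\times\mathbb Z)$ is unitary and satisfies $\Pi^{\mu+1,\nu}_a\,U=U\,\Pi^{\mu\nu}_{J(a)}$ for all $a\in D^c_{\mu+1,\nu}$. -/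

import Mathlib

open MeasureTheory Filter Topology
open scoped MultiplierAlgebra ZeroAtInfty ENNReal BoundedContinuousFunction

noncomputable section

namespace QHM

section Extension

variable {A : Type*} [NonUnitalCStarAlgebra A]
  {H : Type*} [NormedAddCommGroup H] [InnerProductSpace ℂ H] [CompleteSpace H]

/-- Nondegeneracy of a representation: no nonzero vector is annihilated by the algebra.
For a *-representation this is the same as density of the span of `ρ(A)H`
(`dense_of_nondegenerate` is the direction that is used below). -/
def Nondegenerate (ρ : A →⋆ₙₐ[ℂ] (H →L[ℂ] H)) : Prop :=
  ∀ h : H, (∀ a : A, ρ a h = 0) → h = 0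

/-- `∑ᵢ cᵢ (aᵢ, hᵢ) ↦ ∑ᵢ cᵢ ρ(aᵢ) hᵢ`. -/
def evalMap (ρ : A →⋆ₙₐ[ℂ] (H →L[ℂ] H)) : (A × H →₀ ℂ) →ₗ[ℂ] H :=
  Finsupp.linearCombination ℂ (fun x : A × H => ρ x.1 x.2)

/-- `∑ᵢ cᵢ (aᵢ, hᵢ) ↦ ∑ᵢ cᵢ ρ(m aᵢ) hᵢ`. -/
def evalMulMap (ρ : A →⋆ₙₐ[ℂ] (H →L[ℂ] H)) (m : 𝓜(ℂ, A)) : (A × H →₀ ℂ) →ₗ[ℂ] H :=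
  Finsupp.linearCombination ℂ (fun x : A × H => ρ (m.fst x.1) x.2)

theorem mult_left_cancel {a b : A} (h : ∀ x : A, x * a = x * b) : a = b := by
  have h1 : star (a - b) * (a - b) = 0 := by rw [mul_sub, h, sub_self]
  exact sub_eq_zero.mp (CStarRing.star_mul_self_eq_zero_iff _ |>.mp h1)

theorem mult_fst_mul (m : 𝓜(ℂ, A)) (a b : A) : m.fst (a * b) = m.fst a * b :=
  mult_left_cancel fun x => by
    rw [← m.central, ← mul_assoc, ← mul_assoc, m.central]

theorem mult_snd_mul (m : 𝓜(ℂ, A)) (a b : A) : m.snd (a * b) = a * m.snd b := by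
  have h := congrArg star (mult_fst_mul (star m) (star b) (star a))
  simpa using h

theorem mult_ext {m n : 𝓜(ℂ, A)} (h : ∀ a, m.fst a = n.fst a) : m = n := by
  have h1 : m.fst = n.fst := ContinuousLinearMap.ext h
  have h2 : ‖m - n‖ = 0 := by
    rw [← DoubleCentralizer.norm_fst, DoubleCentralizer.sub_fst, h1, sub_self, norm_zero]
  exact sub_eq_zero.mp (norm_eq_zero.mp h2)

theorem dense_of_nondegenerate {ρ : A →⋆ₙₐ[ℂ] (H →L[ℂ] H)} (hρ : Nondegenerate ρ) :
    DenseRange (evalMap ρ) := by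
  have key : (LinearMap.range (evalMap ρ)).topologicalClosure = ⊤ := by
    rw [Submodule.topologicalClosure_eq_top_iff, Submodule.eq_bot_iff]
    intro h hh
    refine hρ h fun a => ?_
    have h0 : inner ℂ (ρ (star a) (ρ a h)) h = 0 := by
      refine (Submodule.mem_orthogonal _ _).mp hh _ ⟨Finsupp.single (star a, ρ a h) 1, ?_⟩
      simp [evalMap]
    rw [map_star, ContinuousLinearMap.star_eq_adjoint, ContinuousLinearMap.adjoint_inner_left]
      at h0
    exact inner_self_eq_zero.mp h0
  have := congrArg (fun S : Submodule ℂ H => (S : Set H)) key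
  simpa [DenseRange, dense_iff_closure_eq, ← LinearMap.coe_range] using this

theorem norm_evalMulMap_le (ρ : A →⋆ₙₐ[ℂ] (H →L[ℂ] H)) (m : 𝓜(ℂ, A)) (z : A × H →₀ ℂ) :
    ‖evalMulMap ρ m z‖ ≤ ‖m‖ * ‖evalMap ρ z‖ := by
  let _ := CStarAlgebra.spectralOrder A
  have _ := CStarAlgebra.spectralOrderedRing A
  have hu := CStarAlgebra.increasingApproximateUnit A
  have h1 : Tendsto (fun u : A => ρ (m.fst u) (evalMap ρ z)) (CStarAlgebra.approximateUnit A)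
      (𝓝 (evalMulMap ρ m z)) := by
    have h2 : ∀ u : A, ρ (m.fst u) (evalMap ρ z)
        = z.sum fun x c => c • ρ (m.fst (u * x.1)) x.2 := by
      intro u
      simp only [evalMap, Finsupp.linearCombination_apply, Finsupp.sum, map_sum, map_smul,
        mult_fst_mul, map_mul, mul_apply_eq_comp]
    simp only [h2]
    simp only [evalMulMap, Finsupp.linearCombination_apply, Finsupp.sum]
    refine tendsto_finsetSum _ fun x _ => Tendsto.const_smul ?_ _
    have h3 : Continuous fun a : A => ρ (m.fst a) x.2 := by
      have : Continuous (fun a : A => ρ a) := 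
        AddMonoidHomClass.continuous_of_bound ρ 1 fun a => by
          simpa using NonUnitalStarAlgHom.norm_apply_le ρ a
      exact (this.comp m.fst.continuous).clm_apply continuous_const
    exact (h3.tendsto x.1).comp (hu.tendsto_mul_right x.1)
  refine le_of_tendsto h1.norm ?_
  filter_upwards [hu.eventually_norm] with u hu1
  calc ‖ρ (m.fst u) (evalMap ρ z)‖ ≤ ‖ρ (m.fst u)‖ * ‖evalMap ρ z‖ :=
        ContinuousLinearMap.le_opNorm _ _
    _ ≤ ‖m‖ * ‖evalMap ρ z‖ := by
        gcongr
        calc ‖ρ (m.fst u)‖ ≤ ‖m.fst u‖ := NonUnitalStarAlgHom.norm_apply_le ρ _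
          _ ≤ ‖m.fst‖ * ‖u‖ := m.fst.le_opNorm u
          _ ≤ ‖m‖ * 1 := by rw [DoubleCentralizer.norm_fst]; gcongr
          _ = ‖m‖ := mul_one _

theorem ext_of_nondegenerate {ρ : A →⋆ₙₐ[ℂ] (H →L[ℂ] H)} (hρ : Nondegenerate ρ)
    {S T : H →L[ℂ] H} (h : ∀ a x, S (ρ a x) = T (ρ a x)) : S = T := by
  have := (dense_of_nondegenerate hρ).equalizer S.continuous T.continuous (by
    funext z
    simp only [Function.comp_apply, evalMap, Finsupp.linearCombination_apply, Finsupp.sum,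
      map_sum, map_smul, h])
  exact ContinuousLinearMap.ext fun x => congrFun this x

/-- The operator `ρ̄(m)` with `ρ̄(m) ρ(a) h = ρ(m a) h`. -/
def extendOp (ρ : A →⋆ₙₐ[ℂ] (H →L[ℂ] H)) (m : 𝓜(ℂ, A)) : H →L[ℂ] H :=
  (evalMulMap ρ m).extendOfNorm (evalMap ρ)

theorem extendOp_apply {ρ : A →⋆ₙₐ[ℂ] (H →L[ℂ] H)} (hρ : Nondegenerate ρ) (m : 𝓜(ℂ, A))
    (a : A) (h : H) : extendOp ρ m (ρ a h) = ρ (m.fst a) h := by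
  have := LinearMap.extendOfNorm_eq (dense_of_nondegenerate hρ)
    ⟨‖m‖, norm_evalMulMap_le ρ m⟩ (Finsupp.single (a, h) 1)
  simpa [evalMap, evalMulMap, extendOp] using this

/-- The canonical extension of a nondegenerate representation to the multiplier algebra. -/
def extendRep (ρ : A →⋆ₙₐ[ℂ] (H →L[ℂ] H)) (hρ : Nondegenerate ρ) :
    𝓜(ℂ, A) →⋆ₐ[ℂ] (H →L[ℂ] H) where
  toFun := extendOp ρ
  map_one' := ext_of_nondegenerate hρ fun a x => by
    rw [extendOp_apply hρ]; rfl
  map_mul' m n := ext_of_nondegenerate hρ fun a x => by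
    rw [mul_apply_eq_comp, extendOp_apply hρ, extendOp_apply hρ, extendOp_apply hρ]
    rfl
  map_zero' := ext_of_nondegenerate hρ fun a x => by
    rw [extendOp_apply hρ]; simp
  map_add' m n := ext_of_nondegenerate hρ fun a x => by
    rw [add_apply, extendOp_apply hρ, extendOp_apply hρ, extendOp_apply hρ]
    simp
  commutes' c := ext_of_nondegenerate hρ fun a x => by
    rw [extendOp_apply hρ, DoubleCentralizer.algebraMap_fst]
    simp [Algebra.algebraMap_eq_smul_one]
  map_star' m := ext_of_nondegenerate hρ fun a x => by
    rw [extendOp_apply hρ]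
    refine ext_inner_right ℂ fun y => ?_
    have h : innerSL ℂ (ρ ((star m).fst a) x) = innerSL ℂ (star (extendOp ρ m) (ρ a x)) := by
      have := (dense_of_nondegenerate hρ).equalizer
        (innerSL ℂ (ρ ((star m).fst a) x)).continuous
        (innerSL ℂ (star (extendOp ρ m) (ρ a x))).continuous (by
        funext z
        simp only [Function.comp_apply, evalMap, Finsupp.linearCombination_apply, Finsupp.sum,
          map_sum, map_smul]
        refine Finset.sum_congr rfl fun b _ => ?_
        congr 1
        rw [innerSL_apply_apply, innerSL_apply_apply, ContinuousLinearMap.star_eq_adjoint,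
          ContinuousLinearMap.adjoint_inner_left, extendOp_apply hρ,
          ← ContinuousLinearMap.adjoint_inner_right, ← ContinuousLinearMap.adjoint_inner_right,
          ← ContinuousLinearMap.star_eq_adjoint, ← ContinuousLinearMap.star_eq_adjoint,
          ← map_star ρ, ← map_star ρ, DoubleCentralizer.star_fst, star_star,
          ← mul_apply_eq_comp, ← mul_apply_eq_comp, ← map_mul ρ,
          ← map_mul ρ, m.central])
      exact ContinuousLinearMap.ext fun x => congrFun this x
    exact congrArg (fun f : H →L[ℂ] ℂ => f y) h

theorem extendRep_apply {ρ : A →⋆ₙₐ[ℂ] (H →L[ℂ] H)} (hρ : Nondegenerate ρ) (m : 𝓜(ℂ, A))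
    (a : A) (h : H) : extendRep ρ hρ m (ρ a h) = ρ (m.fst a) h :=
  extendOp_apply hρ m a h

theorem extendRep_mul {ρ : A →⋆ₙₐ[ℂ] (H →L[ℂ] H)} (hρ : Nondegenerate ρ) (m : 𝓜(ℂ, A))
    (a : A) : extendRep ρ hρ m * ρ a = ρ (m.fst a) :=
  ContinuousLinearMap.ext fun h => extendOp_apply hρ m a h

end Extension

section CrossedProduct

variable {A : Type} [NonUnitalCStarAlgebra A]

/-- A covariant representation of the `ℤ`-action generated by the automorphism `α`: a
nondegenerate representation `π` and a unitary `V` on a Hilbert space with `V π(a) V* = π(α a)`. -/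
structure CovRep (α : A ≃⋆ₐ[ℂ] A) where
  H : Type
  [normed : NormedAddCommGroup H]
  [inner : InnerProductSpace ℂ H]
  [complete : CompleteSpace H]
  π : A →⋆ₙₐ[ℂ] (H →L[ℂ] H)
  nondeg : Nondegenerate π
  V : unitary (H →L[ℂ] H)
  cov : ∀ a, (V : H →L[ℂ] H) * π a = π (α a) * (V : H →L[ℂ] H)

attribute [instance] CovRep.normed CovRep.inner CovRep.complete

variable (α : A ≃⋆ₐ[ℂ] A)

theorem CovRep.cov_zpow {α : A ≃⋆ₐ[ℂ] A} (R : CovRep α) (p : ℤ) (a : A) :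
    ((R.V ^ p : unitary _) : R.H →L[ℂ] R.H) * R.π a
      = R.π ((α ^ p) a) * ((R.V ^ p : unitary _) : R.H →L[ℂ] R.H) := by
  have hinv : ∀ a : A, ((R.V⁻¹ : unitary _) : R.H →L[ℂ] R.H) * R.π a
      = R.π ((α⁻¹) a) * ((R.V⁻¹ : unitary _) : R.H →L[ℂ] R.H) := by
    intro a
    have h1 : α (α⁻¹ a) = a := by
      have : (α * α⁻¹) a = a := by rw [mul_inv_cancel]; rfl
      exact this
    have h := R.cov (α⁻¹ a)
    rw [h1] at h
    have e1 : ((R.V⁻¹ : unitary _) : R.H →L[ℂ] R.H) * (R.V : R.H →L[ℂ] R.H) = 1 := by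
      rw [← Submonoid.coe_mul, inv_mul_cancel]; rfl
    have e2 : (R.V : R.H →L[ℂ] R.H) * ((R.V⁻¹ : unitary _) : R.H →L[ℂ] R.H) = 1 := by
      rw [← Submonoid.coe_mul, mul_inv_cancel]; rfl
    calc _ = ((R.V⁻¹ : unitary _) : R.H →L[ℂ] R.H) * (R.π a * (R.V : R.H →L[ℂ] R.H))
          * ((R.V⁻¹ : unitary _) : R.H →L[ℂ] R.H) := by
          rw [mul_assoc, mul_assoc, e2, mul_one]
      _ = _ := by rw [← h, ← mul_assoc, e1, one_mul]
  induction p generalizing a with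
  | zero => simp
  | succ n ih =>
    rw [zpow_add_one, zpow_add_one, Submonoid.coe_mul, mul_assoc, R.cov, ← mul_assoc, ih,
      mul_assoc]
    rfl
  | pred n ih =>
    rw [zpow_sub_one, zpow_sub_one, Submonoid.coe_mul, mul_assoc, hinv, ← mul_assoc, ih,
      mul_assoc]
    rfl

/-- The product of the algebras of bounded operators of all covariant representations. -/
def BigAlg : Type 1 := lp (fun R : CovRep α => (R.H →L[ℂ] R.H)) ∞

instance : NonUnitalCStarAlgebra (BigAlg α) :=
  inferInstanceAs (NonUnitalCStarAlgebra (lp (fun R : CovRep α => (R.H →L[ℂ] R.H)) ∞))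

variable {α}

/-- The component of an element of the product in one covariant representation. -/
def BigAlg.comp (S : BigAlg α) (R : CovRep α) : R.H →L[ℂ] R.H := S.1 R

theorem BigAlg.mul_comp (S T : BigAlg α) (R : CovRep α) :
    (S * T).comp R = S.comp R * T.comp R := rfl

theorem BigAlg.star_comp (S : BigAlg α) (R : CovRep α) : (star S).comp R = star (S.comp R) := rfl

theorem BigAlg.add_comp (S T : BigAlg α) (R : CovRep α) :
    (S + T).comp R = S.comp R + T.comp R := rfl

theorem BigAlg.smul_comp (c : ℂ) (S : BigAlg α) (R : CovRep α) :
    (c • S).comp R = c • S.comp R := rfl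

/-- The family of the operators that a multiplier of the coefficient algebra defines in the
covariant representations. -/
def coeffOp (m : 𝓜(ℂ, A)) : BigAlg α :=
  ⟨fun R => extendRep R.π R.nondeg m, memℓp_infty ⟨‖m‖, by
    rintro _ ⟨R, rfl⟩
    exact NonUnitalStarAlgHom.norm_apply_le (extendRep R.π R.nondeg) m⟩⟩

variable (α) in
/-- The family of the unitaries `V ^ p`. -/
def shiftOp (p : ℤ) : BigAlg α :=
  ⟨fun R => ((R.V ^ p : unitary _) : R.H →L[ℂ] R.H), memℓp_infty ⟨1, by
    rintro _ ⟨R, rfl⟩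
    refine ContinuousLinearMap.opNorm_le_bound _ zero_le_one fun x => ?_
    rw [one_mul, Unitary.norm_map]⟩⟩

/-- The family of the operators `π(a) V ^ p`, that is, the function on `ℤ` with the value `a` at
`p` and `0` elsewhere, in all covariant representations. -/
def gen (a : A) (p : ℤ) : BigAlg α := coeffOp (a : 𝓜(ℂ, A)) * shiftOp α p

theorem bigAlg_ext {S T : BigAlg α} (h : ∀ R, S.comp R = T.comp R) : S = T :=
  lp.ext (funext h)

theorem coeffOp_coe_apply (a : A) (R : CovRep α) :
    (coeffOp (α := α) (a : 𝓜(ℂ, A))).comp R = R.π a := by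
  refine ext_of_nondegenerate R.nondeg fun b x => ?_
  change extendRep R.π R.nondeg _ _ = _
  rw [extendRep_apply, DoubleCentralizer.coe_fst, ContinuousLinearMap.mul_apply', map_mul]
  rfl

theorem gen_apply (a : A) (p : ℤ) (R : CovRep α) :
    (gen (α := α) a p).comp R = R.π a * ((R.V ^ p : unitary _) : R.H →L[ℂ] R.H) := by
  rw [← coeffOp_coe_apply]; rfl

theorem shiftOp_mul_gen (p : ℤ) (a : A) (q : ℤ) :
    shiftOp α p * gen a q = gen ((α ^ p) a) (p + q) := by
  refine bigAlg_ext fun R => ?_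
  change ((R.V ^ p : unitary _) : R.H →L[ℂ] R.H) * (gen a q).comp R = _
  rw [gen_apply, gen_apply, ← mul_assoc, R.cov_zpow, mul_assoc, ← Submonoid.coe_mul, zpow_add]

theorem gen_mul_shiftOp (p : ℤ) (a : A) (q : ℤ) : gen a q * shiftOp α p = gen a (q + p) := by
  refine bigAlg_ext fun R => ?_
  change (gen a q).comp R * ((R.V ^ p : unitary _) : R.H →L[ℂ] R.H) = _
  rw [gen_apply, gen_apply, mul_assoc, ← Submonoid.coe_mul, zpow_add]

theorem coeffOp_mul_gen (m : 𝓜(ℂ, A)) (a : A) (q : ℤ) :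
    coeffOp m * gen a q = gen (α := α) (m.fst a) q := by
  refine bigAlg_ext fun R => ?_
  change extendRep R.π R.nondeg m * (gen a q).comp R = _
  rw [gen_apply, gen_apply, ← mul_assoc, extendRep_mul]

theorem star_coeffOp (m : 𝓜(ℂ, A)) : star (coeffOp m : BigAlg α) = coeffOp (star m) :=
  bigAlg_ext fun R => (map_star (extendRep R.π R.nondeg) m).symm

theorem coeffOp_mul (m n : 𝓜(ℂ, A)) : (coeffOp (m * n) : BigAlg α) = coeffOp m * coeffOp n :=
  bigAlg_ext fun R => map_mul (extendRep R.π R.nondeg) m n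

theorem star_shiftOp (p : ℤ) : star (shiftOp α p) = shiftOp α (-p) := by
  refine bigAlg_ext fun R => ?_
  change star ((R.V ^ p : unitary _) : R.H →L[ℂ] R.H) = ((R.V ^ (-p) : unitary _) : _)
  rw [zpow_neg, ← Unitary.star_eq_inv, Unitary.coe_star]

theorem shiftOp_mul (p q : ℤ) : shiftOp α p * shiftOp α q = shiftOp α (p + q) := by
  refine bigAlg_ext fun R => ?_
  change ((R.V ^ p : unitary _) : R.H →L[ℂ] R.H) * ((R.V ^ q : unitary _) : R.H →L[ℂ] R.H)
    = ((R.V ^ (p + q) : unitary _) : _)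
  rw [zpow_add, Submonoid.coe_mul]

theorem gen_mul_gen (a : A) (p : ℤ) (b : A) (q : ℤ) :
    gen a p * gen b q = gen (α := α) (a * (α ^ p) b) (p + q) := by
  conv_lhs => rw [gen, mul_assoc, shiftOp_mul_gen, coeffOp_mul_gen]
  rfl

theorem star_gen (a : A) (p : ℤ) : star (gen a p : BigAlg α) = gen ((α ^ (-p)) (star a)) (-p) := by
  have h : star (a : 𝓜(ℂ, A)) = ((star a : A) : 𝓜(ℂ, A)) :=
    (map_star (DoubleCentralizer.coeHom (𝕜 := ℂ) (A := A)) a).symm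
  rw [gen, star_mul, star_shiftOp, star_coeffOp, h]
  have h2 : coeffOp ((star a : A) : 𝓜(ℂ, A)) = gen (α := α) (star a) 0 := by
    refine bigAlg_ext fun R => ?_
    rw [gen_apply, coeffOp_coe_apply]; simp
  rw [h2, shiftOp_mul_gen, add_zero]

theorem gen_mul_coeffOp (m : 𝓜(ℂ, A)) (a : A) (q : ℤ) :
    gen a q * coeffOp m = gen (α := α) ((α ^ q) (m.snd ((α ^ (-q)) a))) q := by
  have hh : ∀ (p : ℤ) (b : A), (α ^ p) ((α ^ (-p)) b) = b := by
    intro p b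
    have : (α ^ p * α ^ (-p)) b = b := by rw [← zpow_add, add_neg_cancel, zpow_zero]; rfl
    exact this
  rw [← star_inj, star_mul, star_gen, star_coeffOp, coeffOp_mul_gen, star_gen]
  congr 1
  have := hh (-q)
  simp only [neg_neg, zpow_neg] at this
  simp [← map_star, this]

variable (α) in
/-- The finite sums `∑ aₚ V ^ p`: the image of the convolution *-algebra of finitely supported
functions `ℤ → A`. -/
def finiteSums : NonUnitalStarSubalgebra ℂ (BigAlg α) where
  toNonUnitalSubalgebra := (Submodule.span ℂ (Set.range fun x : A × ℤ => gen (α := α) x.1 x.2))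
    |>.toNonUnitalSubalgebra (by
      intro x y hx hy
      induction hx, hy using Submodule.span_induction₂ with
      | mem_mem x y hx hy =>
        obtain ⟨⟨a, p⟩, rfl⟩ := hx
        obtain ⟨⟨b, q⟩, rfl⟩ := hy
        exact Submodule.subset_span ⟨(_, _), (gen_mul_gen a p b q).symm⟩
      | zero_left y hy => simp
      | zero_right x hx => simp
      | add_left x y z _ _ _ h1 h2 => rw [add_mul]; exact add_mem h1 h2
      | add_right x y z _ _ _ h1 h2 => rw [mul_add]; exact add_mem h1 h2
      | smul_left r x y _ _ h => rw [smul_mul_assoc]; exact Submodule.smul_mem _ _ h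
      | smul_right r x y _ _ h => rw [mul_smul_comm]; exact Submodule.smul_mem _ _ h)
  star_mem' := by
    intro x hx
    change x ∈ Submodule.span ℂ _ at hx
    change star x ∈ Submodule.span ℂ _
    induction hx using Submodule.span_induction with
    | mem x hx =>
      obtain ⟨⟨a, p⟩, rfl⟩ := hx
      exact Submodule.subset_span ⟨(_, _), (star_gen a p).symm⟩
    | zero => simp
    | add x y _ _ h1 h2 => rw [star_add]; exact add_mem h1 h2
    | smul r x _ h => rw [star_smul]; exact Submodule.smul_mem _ _ h

variable (α) in
/-- The (full) crossed product `A ⋊ ℤ`: the completion of the convolution *-algebra of finitely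
supported functions `ℤ → A` in the supremum of the norms given by all covariant representations. -/
def crossedProduct : NonUnitalStarSubalgebra ℂ (BigAlg α) := (finiteSums α).topologicalClosure

instance : IsClosed (crossedProduct α : Set (BigAlg α)) :=
  (finiteSums α).isClosed_topologicalClosure

instance : NonUnitalCStarAlgebra (crossedProduct α) :=
  NonUnitalStarSubalgebra.nonUnitalCStarAlgebra _

theorem gen_mem (a : A) (p : ℤ) : gen a p ∈ crossedProduct α :=
  (finiteSums α).le_topologicalClosure (Submodule.subset_span ⟨(a, p), rfl⟩)

theorem crossedProduct_induction {P : BigAlg α → Prop} (hg : ∀ a p, P (gen a p)) (h0 : P 0)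
    (ha : ∀ x y, P x → P y → P (x + y)) (hs : ∀ (c : ℂ) x, P x → P (c • x))
    (hc : IsClosed {x | P x}) {x : BigAlg α} (hx : x ∈ crossedProduct α) : P x := by
  have h1 : ((finiteSums α : NonUnitalStarSubalgebra ℂ (BigAlg α)) : Set (BigAlg α))
      ⊆ {x | P x} := by
    intro y hy
    change y ∈ Submodule.span ℂ _ at hy
    induction hy using Submodule.span_induction with
    | mem x hx => obtain ⟨⟨a, p⟩, rfl⟩ := hx; exact hg a p
    | zero => exact h0
    | add x y _ _ h1 h2 => exact ha x y h1 h2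
    | smul r x _ h => exact hs r x h
  exact closure_minimal h1 hc hx

/-- Elements of the ambient algebra that multiply the crossed product into itself. -/
def Normalizes (T : BigAlg α) : Prop :=
  (∀ a p, T * gen a p ∈ crossedProduct α) ∧ ∀ a p, gen a p * T ∈ crossedProduct α

theorem Normalizes.left {T : BigAlg α} (hT : Normalizes T) {x : BigAlg α}
    (hx : x ∈ crossedProduct α) : T * x ∈ crossedProduct α := by
  refine crossedProduct_induction (P := fun x => T * x ∈ crossedProduct α) hT.1 ?_ ?_ ?_ ?_ hx
  · simp only [mul_zero]; exact zero_mem _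
  · intro x y h1 h2; rw [mul_add]; exact add_mem h1 h2
  · intro c x h; rw [mul_smul_comm]; exact SMulMemClass.smul_mem c h
  · exact (finiteSums α).isClosed_topologicalClosure.preimage (continuous_const_mul T)

theorem Normalizes.right {T : BigAlg α} (hT : Normalizes T) {x : BigAlg α}
    (hx : x ∈ crossedProduct α) : x * T ∈ crossedProduct α := by
  refine crossedProduct_induction (P := fun x => x * T ∈ crossedProduct α) hT.2 ?_ ?_ ?_ ?_ hx
  · simp only [zero_mul]; exact zero_mem _
  · intro x y h1 h2; rw [add_mul]; exact add_mem h1 h2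
  · intro c x h; rw [smul_mul_assoc]; exact SMulMemClass.smul_mem c h
  · exact (finiteSums α).isClosed_topologicalClosure.preimage (continuous_mul_const T)

variable (α) in
/-- The multiplier algebra of the crossed product. -/
def MultAlg : Type 1 := 𝓜(ℂ, crossedProduct α)

instance : CStarAlgebra (MultAlg α) := inferInstanceAs (CStarAlgebra 𝓜(ℂ, crossedProduct α))

theorem multAlg_ext {S T : MultAlg α}
    (h : ∀ x, (DoubleCentralizer.toProd S).1 x = (DoubleCentralizer.toProd T).1 x) : S = T :=
  mult_ext (A := crossedProduct α) h

/-- The multiplier `(x ↦ T x, x ↦ x T)` of the crossed product. -/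
def multOf (T : BigAlg α) (hT : Normalizes T) : MultAlg α where
  fst := LinearMap.mkContinuous
    { toFun := fun x => ⟨T * x, hT.left x.2⟩
      map_add' := fun x y => Subtype.ext (mul_add T (x : BigAlg α) y)
      map_smul' := fun c x => Subtype.ext (mul_smul_comm c T (x : BigAlg α)) } ‖T‖
    fun x => norm_mul_le T (x : BigAlg α)
  snd := LinearMap.mkContinuous
    { toFun := fun x => ⟨x * T, hT.right x.2⟩
      map_add' := fun x y => Subtype.ext (add_mul (x : BigAlg α) y T)
      map_smul' := fun c x => Subtype.ext (smul_mul_assoc c (x : BigAlg α) T) } ‖T‖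
    fun x => (norm_mul_le (x : BigAlg α) T).trans_eq (mul_comm _ _)
  central := fun x y => Subtype.ext (mul_assoc (x : BigAlg α) T y)

theorem multOf_fst (T : BigAlg α) (hT : Normalizes T) (x : crossedProduct α) :
    (((DoubleCentralizer.toProd (multOf T hT)).1 x : crossedProduct α) : BigAlg α) = T * x := rfl

theorem coeff_normalizes (m : 𝓜(ℂ, A)) : Normalizes (coeffOp m : BigAlg α) :=
  ⟨fun a p => by rw [coeffOp_mul_gen]; exact gen_mem _ _,
    fun a p => by rw [gen_mul_coeffOp]; exact gen_mem _ _⟩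

theorem shift_normalizes (p : ℤ) : Normalizes (shiftOp α p) :=
  ⟨fun a q => by rw [shiftOp_mul_gen]; exact gen_mem _ _,
    fun a q => by rw [gen_mul_shiftOp]; exact gen_mem _ _⟩

variable (α) in
/-- A multiplier of the coefficient algebra as a multiplier of the crossed product. -/
def coeffMult (m : 𝓜(ℂ, A)) : MultAlg α := multOf (coeffOp m) (coeff_normalizes m)

variable (α) in
/-- The canonical unitary multiplier of the crossed product that implements `α ^ p`. -/
def shiftMult (p : ℤ) : MultAlg α := multOf (shiftOp α p) (shift_normalizes p)

theorem coeffMult_mul (m n : 𝓜(ℂ, A)) : coeffMult α (m * n) = coeffMult α m * coeffMult α n :=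
  multAlg_ext fun x => Subtype.ext (by
    change coeffOp (m * n) * (x : BigAlg α) = coeffOp m * (coeffOp n * (x : BigAlg α))
    rw [coeffOp_mul, mul_assoc])

theorem coeffMult_add (m n : 𝓜(ℂ, A)) : coeffMult α (m + n) = coeffMult α m + coeffMult α n :=
  multAlg_ext fun x => Subtype.ext (by
    change coeffOp (m + n) * (x : BigAlg α) = coeffOp m * (x : BigAlg α) + coeffOp n * (x : BigAlg α)
    rw [← add_mul]
    congr 1
    exact bigAlg_ext fun R => map_add (extendRep R.π R.nondeg) m n)

theorem coeffMult_smul (c : ℂ) (m : 𝓜(ℂ, A)) : coeffMult α (c • m) = c • coeffMult α m :=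
  multAlg_ext fun x => Subtype.ext (by
    change coeffOp (c • m) * (x : BigAlg α) = c • (coeffOp m * (x : BigAlg α))
    rw [← smul_mul_assoc]
    congr 1
    exact bigAlg_ext fun R => map_smul (extendRep R.π R.nondeg) c m)

theorem coeffMult_zero : coeffMult α (0 : 𝓜(ℂ, A)) = 0 := by
  have := coeffMult_smul (α := α) 0 (0 : 𝓜(ℂ, A))
  simpa using this

theorem coeffMult_one : coeffMult α (1 : 𝓜(ℂ, A)) = 1 :=
  multAlg_ext fun x => Subtype.ext (by
    change (coeffOp 1 : BigAlg α) * (x : BigAlg α) = (x : BigAlg α)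
    refine bigAlg_ext fun R => ?_
    rw [BigAlg.mul_comp]
    exact (congrArg (· * _) (map_one (extendRep R.π R.nondeg))).trans (one_mul _))

theorem coeffMult_star (m : 𝓜(ℂ, A)) : star (coeffMult α m) = coeffMult α (star m) :=
  multAlg_ext fun x => Subtype.ext (by
    change star (star (x : BigAlg α) * coeffOp m) = coeffOp (star m) * (x : BigAlg α)
    rw [star_mul, star_star, star_coeffOp])

theorem shiftMult_star (p : ℤ) : star (shiftMult α p) = shiftMult α (-p) :=
  multAlg_ext fun x => Subtype.ext (by
    change star (star (x : BigAlg α) * shiftOp α p) = shiftOp α (-p) * (x : BigAlg α)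
    rw [star_mul, star_star, star_shiftOp])

theorem shiftMult_add (p q : ℤ) : shiftMult α (p + q) = shiftMult α p * shiftMult α q :=
  multAlg_ext fun x => Subtype.ext (by
    change shiftOp α (p + q) * (x : BigAlg α) = shiftOp α p * (shiftOp α q * (x : BigAlg α))
    rw [← mul_assoc, shiftOp_mul])

theorem shiftMult_zero : shiftMult α 0 = 1 :=
  multAlg_ext fun x => Subtype.ext (by
    change shiftOp α 0 * (x : BigAlg α) = (x : BigAlg α)
    refine bigAlg_ext fun R => ?_
    rw [BigAlg.mul_comp]
    change ((R.V ^ (0 : ℤ) : unitary _) : R.H →L[ℂ] R.H) * _ = _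
    rw [zpow_zero]
    exact one_mul _)

/-- The covariance relation in the multiplier algebra. -/
theorem shiftMult_mul_coeffMult (p : ℤ) (m n : 𝓜(ℂ, A))
    (hmn : ∀ a, n.fst a = (α ^ p) (m.fst ((α ^ (-p)) a))) :
    shiftMult α p * coeffMult α m = coeffMult α n * shiftMult α p := by
  refine multAlg_ext fun x => Subtype.ext ?_
  change shiftOp α p * (coeffOp m * (x : BigAlg α)) = coeffOp n * (shiftOp α p * (x : BigAlg α))
  refine crossedProduct_induction
    (P := fun x => shiftOp α p * (coeffOp m * x) = coeffOp n * (shiftOp α p * x))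
    ?_ ?_ ?_ ?_ ?_ x.2
  · intro a q
    have h : (α ^ (-p)) ((α ^ p) a) = a := by
      have : (α ^ (-p) * α ^ p) a = a := by rw [← zpow_add, neg_add_cancel, zpow_zero]; rfl
      exact this
    rw [coeffOp_mul_gen, shiftOp_mul_gen, shiftOp_mul_gen, coeffOp_mul_gen, hmn, h]
  · simp
  · intro x y h1 h2; simp only [mul_add, h1, h2]
  · intro c x h; simp only [mul_smul_comm, h]
  · exact isClosed_eq (by fun_prop) (by fun_prop)

variable (α) in
/-- The integrated form of a covariant representation. -/
def CovRep.integrated (R : CovRep α) : crossedProduct α →⋆ₙₐ[ℂ] (R.H →L[ℂ] R.H) where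
  toFun x := (x : BigAlg α).comp R
  map_smul' _ _ := rfl
  map_zero' := rfl
  map_add' _ _ := rfl
  map_mul' _ _ := rfl
  map_star' _ := rfl

theorem CovRep.integrated_nondeg (R : CovRep α) : Nondegenerate (CovRep.integrated α R) := by
  intro h hh
  refine R.nondeg h fun a => ?_
  have := hh ⟨gen a 0, gen_mem a 0⟩
  change (gen a 0).comp R h = 0 at this
  rw [gen_apply] at this
  simpa using this

variable (α) in
/-- The extension of the integrated form to the multiplier algebra of the crossed product. -/
def CovRep.multRep (R : CovRep α) : MultAlg α →⋆ₐ[ℂ] (R.H →L[ℂ] R.H) :=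
  extendRep (A := crossedProduct α) (CovRep.integrated α R) R.integrated_nondeg

theorem CovRep.multRep_multOf (R : CovRep α) (T : BigAlg α) (hT : Normalizes T) :
    CovRep.multRep α R (multOf T hT) = T.comp R :=
  ext_of_nondegenerate R.integrated_nondeg fun a x =>
    extendRep_apply (A := crossedProduct α) R.integrated_nondeg (multOf T hT) a x

end CrossedProduct

section QuantumHeisenberg

/-- The space `ℝ × 𝕋` with `𝕋 = ℝ / ℤ`. -/
abbrev Plane : Type := ℝ × UnitAddCircle

/-- The character `e(t) = exp (2 π i t)`, as a function on `𝕋 = ℝ / ℤ`. -/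
def e (t : UnitAddCircle) : ℂ := (AddCircle.toCircle t : ℂ)

theorem e_coe (x : ℝ) : e (x : UnitAddCircle) = Complex.exp (2 * Real.pi * Complex.I * x) := by
  rw [e, AddCircle.toCircle_apply_mk, Circle.coe_exp]
  push_cast
  congr 1
  ring

theorem e_add (s t : UnitAddCircle) : e (s + t) = e s * e t := by
  simp [e, AddCircle.toCircle_add]

theorem e_zero : e 0 = 1 := by simp [e, AddCircle.toCircle_zero]

theorem norm_e (t : UnitAddCircle) : ‖e t‖ = 1 := Circle.norm_coe _

theorem star_e (t : UnitAddCircle) : star (e t) = e (-t) := by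
  rw [e, e, AddCircle.toCircle_neg, Circle.coe_inv_eq_conj]; rfl

theorem continuous_e : Continuous e := continuous_subtype_val.comp AddCircle.continuous_toCircle

/-- The action `λ_p (x, y) = (x + 2 p μ, y + 2 p ν)` of `ℤ` on `ℝ × 𝕋`. -/
def lam (μ ν : ℝ) (p : ℤ) : Plane ≃ₜ Plane :=
  Homeomorph.addRight (2 * p * μ, ((2 * p * ν : ℝ) : UnitAddCircle))

theorem lam_apply (μ ν : ℝ) (p : ℤ) (x : ℝ) (y : UnitAddCircle) :
    lam μ ν p (x, y) = (x + 2 * p * μ, y + ((2 * p * ν : ℝ) : UnitAddCircle)) := rfl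

theorem lam_add (μ ν : ℝ) (p q : ℤ) (z : Plane) :
    lam μ ν (p + q) z = lam μ ν p (lam μ ν q z) := by
  obtain ⟨x, y⟩ := z
  simp only [lam_apply, Prod.mk.injEq, add_assoc, ← AddCircle.coe_add]
  push_cast
  exact ⟨by ring, by congr 2; ring⟩

theorem lam_zero (μ ν : ℝ) (z : Plane) : lam μ ν 0 z = z := by
  obtain ⟨x, y⟩ := z
  simp [lam_apply]

/-- The automorphism `f ↦ f ∘ λ₋₁` of `C₀(ℝ × 𝕋)`. -/
def autom (μ ν : ℝ) : C₀(Plane, ℂ) ≃⋆ₐ[ℂ] C₀(Plane, ℂ) where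
  toFun f := f.comp (lam μ ν (-1)).toCocompactMap
  invFun f := f.comp (lam μ ν 1).toCocompactMap
  left_inv f := by
    ext z
    change f (lam μ ν (-1) (lam μ ν 1 z)) = f z
    rw [← lam_add, neg_add_cancel, lam_zero]
  right_inv f := by
    ext z
    change f (lam μ ν 1 (lam μ ν (-1) z)) = f z
    rw [← lam_add, add_neg_cancel, lam_zero]
  map_mul' _ _ := rfl
  map_add' _ _ := rfl
  map_star' _ := rfl
  map_smul' _ _ := rfl

theorem autom_apply (μ ν : ℝ) (f : C₀(Plane, ℂ)) (z : Plane) :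
    autom μ ν f z = f (lam μ ν (-1) z) := rfl

theorem autom_inv_apply (μ ν : ℝ) (f : C₀(Plane, ℂ)) (z : Plane) :
    (autom μ ν)⁻¹ f z = f (lam μ ν 1 z) := rfl

theorem autom_zpow_apply (μ ν : ℝ) (p : ℤ) (f : C₀(Plane, ℂ)) (z : Plane) :
    (autom μ ν ^ p) f z = f (lam μ ν (-p) z) := by
  induction p generalizing z with
  | zero => simp [lam_zero]
  | succ n ih =>
    have : (autom μ ν ^ ((n : ℤ) + 1)) f = autom μ ν ((autom μ ν ^ (n : ℤ)) f) := by
      rw [add_comm, zpow_add, zpow_one]; rfl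
    rw [this, autom_apply, ih, ← lam_add, neg_add]
  | pred n ih =>
    have : (autom μ ν ^ (-(n : ℤ) - 1)) f = (autom μ ν)⁻¹ ((autom μ ν ^ (-(n : ℤ))) f) := by
      rw [sub_eq_add_neg, add_comm, zpow_add, zpow_neg_one]; rfl
    have h2 : -(-(n : ℤ)) + 1 = -(-(n : ℤ) - 1) := by ring
    rw [this, autom_inv_apply, ih, ← lam_add, h2]

/-- The pointwise product of a bounded continuous function and a function vanishing at infinity. -/
def mulC0 (φ : Plane →ᵇ ℂ) (f : C₀(Plane, ℂ)) : C₀(Plane, ℂ) where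
  toFun z := φ z * f z
  continuous_toFun := φ.continuous.mul f.continuous
  zero_at_infty' := by
    refine squeeze_zero_norm (a := fun z => ‖φ‖ * ‖f z‖) (fun z => ?_) ?_
    · rw [norm_mul]; gcongr; exact φ.norm_coe_le_norm z
    · simpa using (zero_at_infty f).norm.const_mul ‖φ‖

theorem mulC0_apply (φ : Plane →ᵇ ℂ) (f : C₀(Plane, ℂ)) (z : Plane) :
    mulC0 φ f z = φ z * f z := rfl

theorem norm_mulC0_le (φ : Plane →ᵇ ℂ) (f : C₀(Plane, ℂ)) : ‖mulC0 φ f‖ ≤ ‖φ‖ * ‖f‖ := by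
  rw [← ZeroAtInftyContinuousMap.norm_toBCF_eq_norm]
  refine (BoundedContinuousFunction.norm_le (by positivity)).mpr fun z => ?_
  change ‖φ z * f z‖ ≤ _
  rw [norm_mul]
  gcongr
  · exact φ.norm_coe_le_norm z
  · rw [← ZeroAtInftyContinuousMap.norm_toBCF_eq_norm]
    exact f.toBCF.norm_coe_le_norm z

/-- The operator of multiplication by a bounded continuous function on `C₀(ℝ × 𝕋)`. -/
def mulC0L (φ : Plane →ᵇ ℂ) : C₀(Plane, ℂ) →L[ℂ] C₀(Plane, ℂ) :=
  LinearMap.mkContinuous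
    { toFun := mulC0 φ
      map_add' := fun f g => by ext z; simp [mulC0_apply, mul_add]
      map_smul' := fun c f => by ext z; simp [mulC0_apply]; ring } ‖φ‖ (norm_mulC0_le φ)

/-- A bounded continuous function as a multiplier of `C₀(ℝ × 𝕋)`. -/
def funMult (φ : Plane →ᵇ ℂ) : 𝓜(ℂ, C₀(Plane, ℂ)) where
  fst := mulC0L φ
  snd := mulC0L φ
  central f g := by
    ext z
    change φ z * f z * g z = f z * (φ z * g z)
    ring

theorem funMult_fst (φ : Plane →ᵇ ℂ) (f : C₀(Plane, ℂ)) (z : Plane) :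
    (funMult φ).fst f z = φ z * f z := rfl

variable (c : ℕ) (μ ν : ℝ)

/-- The transformation rule in degree `p`:
`φ(x + k, y) = e(-c k p (y - p ν)) φ(x, y)` for all integers `k`. -/
def Quasi (p : ℤ) (φ : Plane → ℂ) : Prop :=
  ∀ (k : ℤ) (x : ℝ) (y : UnitAddCircle),
    φ (x + k, y) = e (-((c * k * p : ℤ) • (y - ((p * ν : ℝ) : UnitAddCircle)))) * φ (x, y)

/-- The space `D₀` of the functions `Φ ∈ C(ℝ × 𝕋 × ℤ)` that have compact support on `ℤ` and
satisfy `Φ(x + k, y, p) = e(-c k p (y - p ν)) Φ(x, y, p)`. -/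
def D0 : Submodule ℂ C(Plane × ℤ, ℂ) where
  carrier := {Φ | (∃ s : Finset ℤ, ∀ z p, p ∉ s → Φ (z, p) = 0) ∧
    ∀ p : ℤ, Quasi c ν p fun z => Φ (z, p)}
  add_mem' := by
    rintro Φ Ψ ⟨⟨s, hs⟩, h1⟩ ⟨⟨t, ht⟩, h2⟩
    refine ⟨⟨s ∪ t, fun z p hp => ?_⟩, fun p k x y => ?_⟩
    · rw [Finset.mem_union, not_or] at hp
      simp [hs z p hp.1, ht z p hp.2]
    · have e1 := h1 p k x y
      have e2 := h2 p k x y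
      simp only [ContinuousMap.add_apply] at e1 e2 ⊢
      rw [e1, e2]; ring
  zero_mem' := ⟨⟨∅, fun _ _ _ => rfl⟩, fun p k x y => by simp⟩
  smul_mem' := by
    rintro a Φ ⟨⟨s, hs⟩, h1⟩
    refine ⟨⟨s, fun z p hp => ?_⟩, fun p k x y => ?_⟩
    · simp [hs z p hp]
    · have e1 := h1 p k x y
      simp only [ContinuousMap.smul_apply, smul_eq_mul] at e1 ⊢
      rw [e1]; ring

variable {c μ ν}

theorem Quasi.bounded {p : ℤ} {φ : Plane → ℂ} (hφ : Quasi c ν p φ) (hc : Continuous φ) :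
    ∃ C : ℝ, ∀ z, ‖φ z‖ ≤ C := by
  obtain ⟨C, hC⟩ := ((isCompact_Icc (a := (0 : ℝ)) (b := 1)).prod
    (isCompact_univ (X := UnitAddCircle))).exists_bound_of_continuousOn hc.continuousOn
  refine ⟨C, fun z => ?_⟩
  obtain ⟨x, y⟩ := z
  have h := hφ ⌊x⌋ (Int.fract x) y
  rw [Int.fract_add_floor] at h
  rw [h, norm_mul, norm_e, one_mul]
  exact hC _ ⟨⟨Int.fract_nonneg x, (Int.fract_lt_one x).le⟩, trivial⟩

/-- The function `(x, y) ↦ Φ(x, y, p)`. -/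
def slice (Φ : D0 c ν) (p : ℤ) : Plane →ᵇ ℂ :=
  BoundedContinuousFunction.ofNormedAddCommGroup (fun z => Φ.1 (z, p)) (by fun_prop)
    (Classical.choose ((Φ.2.2 p).bounded (by fun_prop)))
    (Classical.choose_spec ((Φ.2.2 p).bounded (by fun_prop)))

theorem slice_apply (Φ : D0 c ν) (p : ℤ) (z : Plane) : slice Φ p z = Φ.1 (z, p) := rfl

theorem slice_quasi (Φ : D0 c ν) (p : ℤ) : Quasi c ν p (slice Φ p) := Φ.2.2 p

theorem slice_zero_of (Φ : D0 c ν) : ∃ s : Finset ℤ, ∀ p ∉ s, slice Φ p = 0 := by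
  obtain ⟨s, hs⟩ := Φ.2.1
  exact ⟨s, fun p hp => by ext z; exact hs z p hp⟩

theorem funMult_add (φ ψ : Plane →ᵇ ℂ) : funMult (φ + ψ) = funMult φ + funMult ψ :=
  mult_ext fun f => by
    ext z
    change (φ z + ψ z) * f z = φ z * f z + ψ z * f z
    ring

theorem funMult_smul (a : ℂ) (φ : Plane →ᵇ ℂ) : funMult (a • φ) = a • funMult φ :=
  mult_ext fun f => by
    ext z
    change (a * φ z) * f z = a * (φ z * f z)
    ring

theorem funMult_zero : funMult 0 = 0 :=
  mult_ext fun f => by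
    ext z
    change 0 * f z = 0
    ring

theorem funMult_one : funMult 1 = 1 :=
  mult_ext fun f => by
    ext z
    change 1 * f z = f z
    ring

theorem funMult_mul (φ ψ : Plane →ᵇ ℂ) : funMult (φ * ψ) = funMult φ * funMult ψ :=
  mult_ext fun f => by
    ext z
    change (φ z * ψ z) * f z = φ z * (ψ z * f z)
    ring

theorem funMult_star (φ : Plane →ᵇ ℂ) : funMult (star φ) = star (funMult φ) :=
  mult_ext fun f => by
    ext z
    change star (φ z) * f z = star (φ z * star (f z))
    rw [star_mul', star_star]

variable (μ) in
/-- The multiplier `φ δ_p` of `C₀(ℝ × 𝕋) ⋊ ℤ`. -/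
def homMult (φ : Plane →ᵇ ℂ) (p : ℤ) : MultAlg (autom μ ν) :=
  coeffMult (autom μ ν) (funMult φ) * shiftMult (autom μ ν) p

theorem homMult_zero (p : ℤ) : homMult μ (ν := ν) 0 p = 0 := by
  rw [homMult, funMult_zero, coeffMult_zero, zero_mul]

variable (c μ ν) in
/-- The inclusion of `D₀` in the multiplier algebra of the crossed product: `Φ` acts as
`∑ₚ Φ(·, ·, p) δ_p`. -/
def toMult : D0 c ν →ₗ[ℂ] MultAlg (autom μ ν) where
  toFun Φ := ∑ᶠ p : ℤ, homMult μ (slice Φ p) p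
  map_add' Φ Ψ := by
    obtain ⟨s, hs⟩ := slice_zero_of Φ
    obtain ⟨t, ht⟩ := slice_zero_of Ψ
    rw [← finsum_add_distrib]
    · refine finsum_congr fun p => ?_
      have : slice (Φ + Ψ) p = slice Φ p + slice Ψ p := rfl
      rw [this, homMult, funMult_add, coeffMult_add, add_mul]; rfl
    · refine s.finite_toSet.subset fun p hp => ?_
      by_contra h
      exact hp (by dsimp only; rw [hs p h, homMult_zero])
    · refine t.finite_toSet.subset fun p hp => ?_
      by_contra h
      exact hp (by dsimp only; rw [ht p h, homMult_zero])
  map_smul' a Φ := by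
    rw [RingHom.id_apply, smul_finsum]
    refine finsum_congr fun p => ?_
    have : slice (a • Φ) p = a • slice Φ p := rfl
    rw [this, homMult, funMult_smul, coeffMult_smul, smul_mul_assoc]; rfl

theorem toMult_eq_sum (Φ : D0 c ν) (s : Finset ℤ) (hs : ∀ p ∉ s, slice Φ p = 0) :
    toMult c μ ν Φ = ∑ p ∈ s, homMult μ (slice Φ p) p :=
  finsum_eq_sum_of_support_subset _ fun p hp => by
    by_contra h
    exact hp (by dsimp only; rw [hs p h, homMult_zero])

/-- The element of `D₀` that is `φ` in degree `p` and `0` in the other degrees. -/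
def single (φ : Plane →ᵇ ℂ) (p : ℤ) (hφ : Quasi c ν p φ) : D0 c ν :=
  ⟨⟨fun w => if w.2 = p then φ w.1 else 0, by
    have h : Continuous fun q : ℤ => if q = p then (1 : ℂ) else 0 := continuous_of_discreteTopology
    have h2 : Continuous fun w : Plane × ℤ => φ w.1 * (if w.2 = p then (1 : ℂ) else 0) :=
      (φ.continuous.comp continuous_fst).mul (h.comp continuous_snd)
    simpa using h2⟩, ⟨{p}, fun z q hq => by
      simpa using fun h => absurd h (by simpa using hq)⟩, fun q k x y => by
      by_cases h : q = p
      · subst h; simpa using hφ k x y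
      · simp [h]⟩

theorem slice_single (φ : Plane →ᵇ ℂ) (p : ℤ) (hφ : Quasi c ν p φ) (q : ℤ) :
    slice (single φ p hφ) q = if q = p then φ else 0 := by
  ext z
  rw [slice_apply]
  by_cases h : q = p <;> simp [single, h]

theorem toMult_single (φ : Plane →ᵇ ℂ) (p : ℤ) (hφ : Quasi c ν p φ) :
    toMult c μ ν (single φ p hφ) = homMult μ φ p := by
  rw [toMult_eq_sum _ {p} (fun q hq => by
    rw [slice_single, if_neg (by simpa using hq)]), Finset.sum_singleton, slice_single, if_pos rfl]

/-- Composition of a bounded continuous function with `λ_p`. -/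
def compLam (μ ν : ℝ) (φ : Plane →ᵇ ℂ) (p : ℤ) : Plane →ᵇ ℂ :=
  φ.compContinuous ⟨lam μ ν p, (lam μ ν p).continuous⟩

theorem shift_funMult (φ : Plane →ᵇ ℂ) (p : ℤ) :
    shiftMult (autom μ ν) p * coeffMult (autom μ ν) (funMult φ)
      = coeffMult (autom μ ν) (funMult (compLam μ ν φ (-p))) * shiftMult (autom μ ν) p := by
  refine shiftMult_mul_coeffMult p _ _ fun f => ?_
  ext z
  rw [autom_zpow_apply, funMult_fst, funMult_fst, autom_zpow_apply, ← lam_add]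
  simp [compLam, lam_zero]

/-- The convolution product of homogeneous elements. -/
theorem homMult_mul (φ ψ : Plane →ᵇ ℂ) (p q : ℤ) :
    homMult μ (ν := ν) φ p * homMult μ ψ q = homMult μ (φ * compLam μ ν ψ (-p)) (p + q) := by
  simp only [homMult]
  rw [mul_assoc, ← mul_assoc (shiftMult _ p), shift_funMult, funMult_mul, coeffMult_mul,
    shiftMult_add]
  simp only [mul_assoc]

/-- The involution on homogeneous elements. -/
theorem homMult_star (φ : Plane →ᵇ ℂ) (p : ℤ) :
    star (homMult μ (ν := ν) φ p) = homMult μ (compLam μ ν (star φ) p) (-p) := by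
  rw [homMult, star_mul, coeffMult_star, shiftMult_star, ← funMult_star, shift_funMult, neg_neg]
  rfl

theorem Quasi.mul_comp {p q : ℤ} {φ ψ : Plane →ᵇ ℂ} (hφ : Quasi c ν p φ) (hψ : Quasi c ν q ψ) :
    Quasi c ν (p + q) (φ * compLam μ ν ψ (-p)) := by
  intro k x y
  have h1 := hφ k x y
  have h2 := hψ k (x + 2 * ((-p : ℤ) : ℝ) * μ) (y + ((2 * ((-p : ℤ) : ℝ) * ν : ℝ) : UnitAddCircle))
  change φ (x + k, y) * ψ (lam μ ν (-p) (x + k, y)) = _ * (φ (x, y) * ψ (lam μ ν (-p) (x, y)))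
  rw [lam_apply, lam_apply, h1, add_right_comm, h2, mul_mul_mul_comm, ← e_add]
  congr 2
  induction y using QuotientAddGroup.induction_on with
  | H y =>
    simp only [← AddCircle.coe_sub, ← AddCircle.coe_add, ← AddCircle.coe_zsmul,
      ← AddCircle.coe_neg]
    congr 1
    simp only [zsmul_eq_mul]
    push_cast
    ring

theorem Quasi.star_comp {p : ℤ} {φ : Plane →ᵇ ℂ} (hφ : Quasi c ν p φ) :
    Quasi c ν (-p) (compLam μ ν (star φ) p) := by
  intro k x y
  have h2 := hφ k (x + 2 * (p : ℝ) * μ) (y + ((2 * (p : ℝ) * ν : ℝ) : UnitAddCircle))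
  change star (φ (lam μ ν p (x + k, y))) = _ * star (φ (lam μ ν p (x, y)))
  rw [lam_apply, lam_apply, add_right_comm, h2, star_mul', star_e]
  congr 2
  induction y using QuotientAddGroup.induction_on with
  | H y =>
    simp only [← AddCircle.coe_sub, ← AddCircle.coe_add, ← AddCircle.coe_zsmul,
      ← AddCircle.coe_neg]
    congr 1
    simp only [zsmul_eq_mul]
    push_cast
    ring

theorem quasi_one : Quasi c ν 0 (1 : Plane →ᵇ ℂ) := fun k x y => by simp [e_zero]

theorem toMult_one : toMult c μ ν (single 1 0 quasi_one) = 1 := by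
  rw [toMult_single, homMult, funMult_one, coeffMult_one, shiftMult_zero, one_mul]

theorem algebraMap_mem_range (a : ℂ) :
    algebraMap ℂ (MultAlg (autom μ ν)) a ∈ LinearMap.range (toMult c μ ν) :=
  ⟨a • single 1 0 quasi_one, by
    rw [(toMult c μ ν).map_smul, toMult_one]
    exact (Algebra.algebraMap_eq_smul_one a).symm⟩

theorem toMult_mul_mem (Φ Ψ : D0 c ν) :
    toMult c μ ν Φ * toMult c μ ν Ψ ∈ LinearMap.range (toMult c μ ν) := by
  obtain ⟨s, hs⟩ := slice_zero_of Φ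
  obtain ⟨t, ht⟩ := slice_zero_of Ψ
  rw [toMult_eq_sum Φ s hs, toMult_eq_sum Ψ t ht, Finset.sum_mul]
  refine Submodule.sum_mem _ fun p _ => ?_
  rw [Finset.mul_sum]
  refine Submodule.sum_mem _ fun q _ => ?_
  rw [homMult_mul]
  exact ⟨_, toMult_single _ _ ((slice_quasi Φ p).mul_comp (slice_quasi Ψ q))⟩

theorem star_toMult_mem (Φ : D0 c ν) :
    star (toMult c μ ν Φ) ∈ LinearMap.range (toMult c μ ν) := by
  obtain ⟨s, hs⟩ := slice_zero_of Φ
  rw [toMult_eq_sum Φ s hs, star_sum]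
  refine Submodule.sum_mem _ fun p _ => ?_
  rw [homMult_star]
  exact ⟨_, toMult_single _ _ (slice_quasi Φ p).star_comp⟩

variable (c μ ν) in
/-- `D₀` as a *-subalgebra of the multiplier algebra of `C₀(ℝ × 𝕋) ⋊ ℤ`. -/
def core : StarSubalgebra ℂ (MultAlg (autom μ ν)) where
  carrier := Set.range (toMult c μ ν)
  add_mem' := by
    rintro _ _ ⟨Φ, rfl⟩ ⟨Ψ, rfl⟩
    exact ⟨Φ + Ψ, map_add _ _ _⟩
  mul_mem' := by
    rintro _ _ ⟨Φ, rfl⟩ ⟨Ψ, rfl⟩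
    exact toMult_mul_mem Φ Ψ
  algebraMap_mem' a := algebraMap_mem_range a
  star_mem' := by
    rintro _ ⟨Φ, rfl⟩
    exact star_toMult_mem Φ

variable (c μ ν) in
/-- The closure of `D₀` in the multiplier algebra of the crossed product `C₀(ℝ × 𝕋) ⋊_λ ℤ`. -/
def closureD0 : StarSubalgebra ℂ (MultAlg (autom μ ν)) := (core c μ ν).topologicalClosure

instance : IsClosed (closureD0 c μ ν : Set (MultAlg (autom μ ν))) :=
  (core c μ ν).isClosed_topologicalClosure

variable (c μ ν) in
/-- The quantum Heisenberg manifold `D^c_{μν}`: the closure of `D₀` in the multiplier algebra of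
the crossed product `C₀(ℝ × 𝕋) ⋊_λ ℤ`, with the C*-algebra structure of the multiplier algebra. -/
def D : Type 1 := closureD0 c μ ν

instance : CStarAlgebra (D c μ ν) := StarSubalgebra.cstarAlgebra (closureD0 c μ ν)

variable (c μ ν) in
/-- The inclusion of `D^c_{μν}` in the multiplier algebra. -/
def D.toMultAlg : D c μ ν →⋆ₐ[ℂ] MultAlg (autom μ ν) where
  toFun a := a.1
  map_one' := rfl
  map_mul' _ _ := rfl
  map_zero' := rfl
  map_add' _ _ := rfl
  commutes' _ := rfl
  map_star' _ := rfl

theorem D.norm_toMultAlg (a : D c μ ν) : ‖D.toMultAlg c μ ν a‖ = ‖a‖ := rfl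

variable (c μ ν) in
/-- The inclusion of `D₀` in `D^c_{μν}`. -/
def incl : D0 c ν →ₗ[ℂ] D c μ ν where
  toFun Φ := ⟨toMult c μ ν Φ, (core c μ ν).le_topologicalClosure ⟨Φ, rfl⟩⟩
  map_add' Φ Ψ := Subtype.ext (map_add (toMult c μ ν) Φ Ψ)
  map_smul' a Φ := Subtype.ext (map_smul (toMult c μ ν) a Φ)

theorem toMultAlg_incl (Φ : D0 c ν) : D.toMultAlg c μ ν (incl c μ ν Φ) = toMult c μ ν Φ := rfl

theorem incl_dense : DenseRange (incl c μ ν) := by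
  intro a
  have h : Topology.IsInducing (D.toMultAlg c μ ν) := Topology.IsInducing.subtypeVal
  rw [h.closure_eq_preimage_closure_image, Set.mem_preimage, ← Set.range_comp]
  exact a.2

/-- Lebesgue measure on `ℝ`, normalized Haar measure on `𝕋`, counting measure on `ℤ`. -/
def measPZ : Measure (Plane × ℤ) := (volume : Measure Plane).prod Measure.count

instance : SFinite measPZ := inferInstanceAs (SFinite ((volume : Measure Plane).prod Measure.count))

/-- The Hilbert space `L²(ℝ × 𝕋 × ℤ)`. -/
abbrev L2 : Type := Lp ℂ 2 measPZ

theorem memLp_mul (g : (Plane × ℤ) →ᵇ ℂ) (ξ : L2) : MemLp (fun w => g w * ξ w) 2 measPZ :=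
  (Lp.memLp ξ).of_le_mul (c := ‖g‖)
    (g.continuous.aestronglyMeasurable.mul (Lp.aestronglyMeasurable ξ))
    (Eventually.of_forall fun w => by
      rw [norm_mul]; gcongr; exact g.norm_coe_le_norm w)

/-- Multiplication by a bounded continuous function on `L²(ℝ × 𝕋 × ℤ)`. -/
def mulOp (g : (Plane × ℤ) →ᵇ ℂ) : L2 →L[ℂ] L2 :=
  LinearMap.mkContinuous
    { toFun := fun ξ => (memLp_mul g ξ).toLp (fun w => g w * ξ w)
      map_add' := fun ξ η => by
        refine Lp.ext ?_
        filter_upwards [(memLp_mul g (ξ + η)).coeFn_toLp, (memLp_mul g ξ).coeFn_toLp,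
          (memLp_mul g η).coeFn_toLp, Lp.coeFn_add ξ η,
          Lp.coeFn_add (memLp_mul g ξ).toLp (memLp_mul g η).toLp] with w h1 h2 h3 h4 h5
        rw [h1, h5, Pi.add_apply, h2, h3, h4, Pi.add_apply, mul_add]
      map_smul' := fun c ξ => by
        refine Lp.ext ?_
        filter_upwards [(memLp_mul g (c • ξ)).coeFn_toLp, (memLp_mul g ξ).coeFn_toLp,
          Lp.coeFn_smul c ξ, Lp.coeFn_smul c (memLp_mul g ξ).toLp] with w h1 h2 h3 h4
        rw [h1, RingHom.id_apply, h4, Pi.smul_apply, h2, h3, Pi.smul_apply, smul_eq_mul,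
          smul_eq_mul]
        ring } ‖g‖ fun ξ => by
    refine Lp.norm_le_mul_norm_of_ae_le_mul ?_
    filter_upwards [(memLp_mul g ξ).coeFn_toLp] with w h1
    change ‖(memLp_mul g ξ).toLp (fun w => g w * ξ w) w‖ ≤ _
    rw [h1, norm_mul]
    gcongr
    exact g.norm_coe_le_norm w

theorem mulOp_coe (g : (Plane × ℤ) →ᵇ ℂ) (ξ : L2) :
    mulOp g ξ =ᵐ[measPZ] fun w => g w * ξ w := (memLp_mul g ξ).coeFn_toLp

theorem mulOp_mul (g h : (Plane × ℤ) →ᵇ ℂ) : mulOp (g * h) = mulOp g * mulOp h := by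
  refine ContinuousLinearMap.ext fun ξ => Lp.ext ?_
  rw [mul_apply_eq_comp]
  filter_upwards [mulOp_coe (g * h) ξ, mulOp_coe g (mulOp h ξ), mulOp_coe h ξ] with w h1 h2 h3
  rw [h1, h2, h3]
  exact mul_assoc _ _ _

theorem mulOp_add (g h : (Plane × ℤ) →ᵇ ℂ) : mulOp (g + h) = mulOp g + mulOp h := by
  refine ContinuousLinearMap.ext fun ξ => Lp.ext ?_
  rw [add_apply]
  filter_upwards [mulOp_coe (g + h) ξ, mulOp_coe g ξ, mulOp_coe h ξ,
    Lp.coeFn_add (mulOp g ξ) (mulOp h ξ)] with w h1 h2 h3 h4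
  rw [h1, h4, Pi.add_apply, h2, h3]
  exact add_mul _ _ _

theorem mulOp_smul (c : ℂ) (g : (Plane × ℤ) →ᵇ ℂ) : mulOp (c • g) = c • mulOp g := by
  refine ContinuousLinearMap.ext fun ξ => Lp.ext ?_
  rw [smul_apply]
  filter_upwards [mulOp_coe (c • g) ξ, mulOp_coe g ξ, Lp.coeFn_smul c (mulOp g ξ)] with w h1 h2 h3
  rw [h1, h3, Pi.smul_apply, h2]
  exact mul_assoc _ _ _

theorem mulOp_zero : mulOp 0 = 0 := by
  have := mulOp_smul 0 0
  simpa using this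

theorem mulOp_star (g : (Plane × ℤ) →ᵇ ℂ) : mulOp (star g) = star (mulOp g) := by
  rw [ContinuousLinearMap.star_eq_adjoint, ContinuousLinearMap.eq_adjoint_iff]
  intro ξ η
  rw [L2.inner_def, L2.inner_def]
  refine integral_congr_ae ?_
  filter_upwards [mulOp_coe (star g) ξ, mulOp_coe g η] with w h1 h2
  rw [h1, h2]
  simp only [RCLike.inner_apply, map_mul]
  change _ * (star (star (g w)) * _) = _
  rw [star_star]
  ring

/-- The function `(z, p) ↦ φ(λ_p z)`. -/
def regFun (μ ν : ℝ) (φ : Plane →ᵇ ℂ) : (Plane × ℤ) →ᵇ ℂ :=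
  φ.compContinuous ⟨fun w => lam μ ν w.2 w.1, by
    have h : Continuous fun p : ℤ => (p : ℝ) := continuous_of_discreteTopology
    change Continuous fun w : Plane × ℤ => (w.1 +
      ((2 * (w.2 : ℝ) * μ, ((2 * (w.2 : ℝ) * ν : ℝ) : UnitAddCircle)) : Plane))
    have h2 : Continuous fun w : Plane × ℤ => (w.2 : ℝ) := h.comp continuous_snd
    refine continuous_fst.add (Continuous.prodMk (by fun_prop) ?_)
    exact (AddCircle.continuous_mk' 1).comp (by fun_prop)⟩

theorem regFun_apply (μ ν : ℝ) (φ : Plane →ᵇ ℂ) (z : Plane) (p : ℤ) :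
    regFun μ ν φ (z, p) = φ (lam μ ν p z) := rfl

/-- The representation of `C₀(ℝ × 𝕋)` on `L²(ℝ × 𝕋 × ℤ)` given by
`(π(f) ξ)(z, p) = f(λ_p z) ξ(z, p)`. -/
def regPi (μ ν : ℝ) : C₀(Plane, ℂ) →⋆ₙₐ[ℂ] (L2 →L[ℂ] L2) where
  toFun f := mulOp (regFun μ ν f.toBCF)
  map_smul' c f := mulOp_smul c (regFun μ ν f.toBCF)
  map_zero' := mulOp_zero
  map_add' f g := mulOp_add (regFun μ ν f.toBCF) (regFun μ ν g.toBCF)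
  map_mul' f g := mulOp_mul (regFun μ ν f.toBCF) (regFun μ ν g.toBCF)
  map_star' f := mulOp_star (regFun μ ν f.toBCF)

theorem regPi_coe (μ ν : ℝ) (f : C₀(Plane, ℂ)) (ξ : L2) :
    regPi μ ν f ξ =ᵐ[measPZ] fun w => f (lam μ ν w.2 w.1) * ξ w := mulOp_coe _ _

theorem measPreserving_shift (q : ℤ) :
    MeasurePreserving (fun w : Plane × ℤ => (w.1, w.2 - q)) measPZ measPZ :=
  (MeasurePreserving.id (volume : Measure Plane)).prod
    (measurePreserving_sub_right (Measure.count : Measure ℤ) q)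

/-- The translation `(ξ(z, p))_{z, p} ↦ (ξ(z, p - q))_{z, p}`. -/
def shiftL (q : ℤ) : L2 →ₗᵢ[ℂ] L2 :=
  Lp.compMeasurePreservingₗᵢ ℂ _ (measPreserving_shift q)

theorem shiftL_coe (q : ℤ) (ξ : L2) :
    shiftL q ξ =ᵐ[measPZ] fun w => ξ (w.1, w.2 - q) :=
  Lp.coeFn_compMeasurePreserving ξ (measPreserving_shift q)

theorem shiftL_add (p q : ℤ) (ξ : L2) : shiftL p (shiftL q ξ) = shiftL (p + q) ξ := by
  refine Lp.ext ?_
  filter_upwards [shiftL_coe p (shiftL q ξ), shiftL_coe (p + q) ξ,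
    (measPreserving_shift p).quasiMeasurePreserving.ae (shiftL_coe q ξ)] with w h1 h2 h3
  rw [h1, h2, h3]
  congr 2
  ring

theorem shiftL_zero (ξ : L2) : shiftL 0 ξ = ξ := by
  refine Lp.ext ?_
  filter_upwards [shiftL_coe 0 ξ] with w h1
  rw [h1, sub_zero]

/-- The translation by `q` in the variable `p ∈ ℤ`, as a unitary operator. -/
def shiftU (q : ℤ) : unitary (L2 →L[ℂ] L2) :=
  Unitary.linearIsometryEquiv.symm
    { (shiftL q) with
      invFun := shiftL (-q)
      left_inv := fun ξ => by
        change shiftL (-q) (shiftL q ξ) = ξ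
        rw [shiftL_add, neg_add_cancel, shiftL_zero]
      right_inv := fun ξ => by
        change shiftL q (shiftL (-q) ξ) = ξ
        rw [shiftL_add, add_neg_cancel, shiftL_zero] }

theorem shiftU_apply (q : ℤ) (ξ : L2) : (shiftU q : L2 →L[ℂ] L2) ξ = shiftL q ξ := rfl

theorem shiftU_coe (q : ℤ) (ξ : L2) :
    (shiftU q : L2 →L[ℂ] L2) ξ =ᵐ[measPZ] fun w => ξ (w.1, w.2 - q) := shiftL_coe q ξ

theorem shiftU_mul (p q : ℤ) : shiftU p * shiftU q = shiftU (p + q) :=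
  Subtype.ext (ContinuousLinearMap.ext fun ξ => shiftL_add p q ξ)

theorem shiftU_zero : shiftU 0 = 1 :=
  Subtype.ext (ContinuousLinearMap.ext fun ξ => shiftL_zero ξ)

theorem shiftU_zpow (q : ℤ) : shiftU 1 ^ q = shiftU q := by
  induction q with
  | zero => rw [zpow_zero, shiftU_zero]
  | succ n ih => rw [zpow_add_one, ih, shiftU_mul]
  | pred n ih =>
    have h : (shiftU 1)⁻¹ = shiftU (-1) :=
      inv_eq_of_mul_eq_one_right (by rw [shiftU_mul, add_neg_cancel, shiftU_zero])
    rw [zpow_sub_one, ih, h, shiftU_mul]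
    rfl

/-- The function `1 / (1 + x²)` on `ℝ × 𝕋`. -/
def bump : C₀(Plane, ℂ) where
  toFun z := ((1 + z.1 ^ 2)⁻¹ : ℝ)
  continuous_toFun := by
    refine Complex.continuous_ofReal.comp (Continuous.inv₀ (by fun_prop) fun z => ?_)
    positivity
  zero_at_infty' := by
    have h1 : Tendsto (fun z : Plane => |z.1|) (cocompact Plane) atTop := by
      rw [tendsto_atTop]
      intro C
      have hK : IsCompact (Set.Icc (-C) C ×ˢ (Set.univ : Set UnitAddCircle)) :=
        isCompact_Icc.prod isCompact_univ
      filter_upwards [hK.compl_mem_cocompact] with z hz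
      by_contra h
      refine hz ⟨?_, trivial⟩
      rw [not_le] at h
      exact ⟨(abs_lt.mp h).1.le, (abs_lt.mp h).2.le⟩
    have h2 : Tendsto (fun t : ℝ => (1 + t ^ 2)⁻¹) atTop (𝓝 0) :=
      tendsto_inv_atTop_zero.comp
        (tendsto_atTop_add_const_left _ _ (tendsto_pow_atTop two_ne_zero))
    have h3 := (Complex.continuous_ofReal.tendsto 0).comp (h2.comp h1)
    simpa [Function.comp_def, sq_abs] using h3

theorem bump_ne_zero (z : Plane) : bump z ≠ 0 := by
  change (((1 + z.1 ^ 2)⁻¹ : ℝ) : ℂ) ≠ 0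
  rw [Complex.ofReal_ne_zero]
  positivity

theorem regPi_nondeg (μ ν : ℝ) : Nondegenerate (regPi μ ν) := by
  intro ξ h
  have h0 := regPi_coe μ ν bump ξ
  rw [h bump] at h0
  refine Lp.ext ?_
  filter_upwards [h0, Lp.coeFn_zero ℂ 2 measPZ] with w h1 h2
  rw [h2] at h1
  rw [h2]
  exact (mul_eq_zero.mp h1.symm).resolve_left (bump_ne_zero _)

/-- The left regular covariant representation on `L²(ℝ × 𝕋 × ℤ)`:
`(π(f) ξ)(z, p) = f(λ_p z) ξ(z, p)` and `(V ξ)(z, p) = ξ(z, p - 1)`. -/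
def regCov (μ ν : ℝ) : CovRep (autom μ ν) where
  H := L2
  π := regPi μ ν
  nondeg := regPi_nondeg μ ν
  V := shiftU 1
  cov f := by
    refine ContinuousLinearMap.ext fun ξ => Lp.ext ?_
    rw [mul_apply_eq_comp, mul_apply_eq_comp]
    filter_upwards [shiftU_coe 1 (regPi μ ν f ξ), shiftU_coe 1 ξ,
      regPi_coe μ ν (autom μ ν f) ((shiftU 1 : L2 →L[ℂ] L2) ξ),
      (measPreserving_shift 1).quasiMeasurePreserving.ae (regPi_coe μ ν f ξ)] with w h1 h2 h3 h4
    rw [h1, h3, h2, h4, autom_apply, ← lam_add]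
    congr 4
    ring

theorem regCov_coeff (φ : Plane →ᵇ ℂ) :
    (coeffOp (funMult φ)).comp (regCov μ ν) = mulOp (regFun μ ν φ) := by
  refine ext_of_nondegenerate (regPi_nondeg μ ν) fun f ξ => ?_
  refine (extendRep_apply (regPi_nondeg μ ν) (funMult φ) f ξ).trans (Lp.ext ?_)
  filter_upwards [regPi_coe μ ν ((funMult φ).fst f) ξ, regPi_coe μ ν f ξ,
    mulOp_coe (regFun μ ν φ) (regPi μ ν f ξ)] with w h1 h2 h3
  rw [h1, h3, h2, funMult_fst, ← mul_assoc]
  rfl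

variable (c μ ν) in
/-- The representation `Π` of `D^c_{μν}` on `L²(ℝ × 𝕋 × ℤ)`: the restriction of the left regular
representation of the multiplier algebra of `C₀(ℝ × 𝕋) ⋊ ℤ`. -/
def regRep : D c μ ν →⋆ₐ[ℂ] (L2 →L[ℂ] L2) :=
  (CovRep.multRep (autom μ ν) (regCov μ ν)).comp (D.toMultAlg c μ ν)

theorem multRep_homMult (φ : Plane →ᵇ ℂ) (q : ℤ) :
    CovRep.multRep (autom μ ν) (regCov μ ν) (homMult μ φ q)
      = mulOp (regFun μ ν φ) * (shiftU q : L2 →L[ℂ] L2) := by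
  rw [homMult, map_mul, coeffMult, shiftMult, CovRep.multRep_multOf, CovRep.multRep_multOf,
    regCov_coeff]
  congr 1
  change ((shiftU 1 ^ q : unitary (L2 →L[ℂ] L2)) : L2 →L[ℂ] L2) = _
  rw [shiftU_zpow]

theorem regRep_incl (Φ : D0 c ν) (s : Finset ℤ) (hs : ∀ q ∉ s, slice Φ q = 0) :
    regRep c μ ν (incl c μ ν Φ)
      = ∑ q ∈ s, mulOp (regFun μ ν (slice Φ q)) * (shiftU q : L2 →L[ℂ] L2) := by
  change CovRep.multRep (autom μ ν) (regCov μ ν) (toMult c μ ν Φ) = _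
  rw [toMult_eq_sum Φ s hs, map_sum]
  exact Finset.sum_congr rfl fun q _ => multRep_homMult _ _

/-- The formula `(Π_Φ ξ)(x, y, p) = ∑_q Φ(x + 2 p μ, y + 2 p ν, q) ξ(x, y, p - q)`. -/
theorem regRep_incl_coe (Φ : D0 c ν) (ξ : L2) :
    regRep c μ ν (incl c μ ν Φ) ξ =ᵐ[measPZ]
      fun w => ∑ᶠ q : ℤ, Φ.1 (lam μ ν w.2 w.1, q) * ξ (w.1, w.2 - q) := by
  obtain ⟨s, hs⟩ := slice_zero_of Φ
  rw [regRep_incl Φ s hs, sum_apply]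
  have h1 : ∀ q : ℤ, (mulOp (regFun μ ν (slice Φ q)) * (shiftU q : L2 →L[ℂ] L2)) ξ =ᵐ[measPZ]
      fun w => Φ.1 (lam μ ν w.2 w.1, q) * ξ (w.1, w.2 - q) := by
    intro q
    rw [mul_apply_eq_comp]
    filter_upwards [mulOp_coe (regFun μ ν (slice Φ q)) ((shiftU q : L2 →L[ℂ] L2) ξ),
      shiftU_coe q ξ] with w h1 h2
    rw [h1, h2]
    rfl
  filter_upwards [Lp.coeFn_finsetSum s (fun q : ℤ =>
    (mulOp (regFun μ ν (slice Φ q)) * (shiftU q : L2 →L[ℂ] L2)) ξ), ae_all_iff.mpr h1] with w h2 h3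
  rw [h2, finsum_eq_sum_of_support_subset (s := s)]
  · rw [Finset.sum_apply]
    exact Finset.sum_congr rfl fun q _ => h3 q
  · intro q hq
    by_contra h
    refine hq ?_
    have := congrArg (fun g : Plane →ᵇ ℂ => g (lam μ ν w.2 w.1)) (hs q h)
    change Φ.1 (lam μ ν w.2 w.1, q) = 0 at this
    dsimp only
    rw [this, zero_mul]

/-- The fundamental domain `(0, 1] × 𝕋` of `𝕋²` in `ℝ × 𝕋`. -/
def box : Set Plane := Set.Ioc 0 1 ×ˢ Set.univ

theorem measurable_box : MeasurableSet box := measurableSet_Ioc.prod MeasurableSet.univ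

theorem volume_box : (volume : Measure Plane) box = 1 := by
  rw [box, Measure.volume_eq_prod, Measure.prod_prod]
  simp

theorem integrable_box (φ : Plane →ᵇ ℂ) : Integrable φ (volume.restrict box) := by
  have : IsFiniteMeasure ((volume : Measure Plane).restrict box) :=
    ⟨by rw [Measure.restrict_apply_univ, volume_box]; exact ENNReal.one_lt_top⟩
  exact φ.integrable _

variable (c ν) in
/-- `Φ ↦ ∫_{𝕋²} Φ(x, y, 0) dx dy` on `D₀`. -/
def trace0 : D0 c ν →ₗ[ℂ] ℂ where
  toFun Φ := ∫ z in box, Φ.1 (z, 0)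
  map_add' Φ Ψ := integral_add (integrable_box (slice Φ 0)) (integrable_box (slice Ψ 0))
  map_smul' a Φ := integral_const_mul a fun z => Φ.1 (z, 0)

theorem box_finite : measPZ (box ×ˢ {(0 : ℤ)}) ≠ ∞ := by
  rw [measPZ, Measure.prod_prod, volume_box]
  simp

theorem measurable_box0 : MeasurableSet (box ×ˢ {(0 : ℤ)}) :=
  measurable_box.prod (measurableSet_singleton 0)

/-- The indicator function of `(0, 1] × 𝕋 × {0}`. -/
def cyc : L2 := indicatorConstLp 2 measurable_box0 box_finite 1

theorem trace0_eq_inner (Φ : D0 c ν) :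
    trace0 c ν Φ = inner ℂ cyc (regRep c μ ν (incl c μ ν Φ) cyc) := by
  rw [cyc, L2.inner_indicatorConstLp_one, ← cyc]
  have h1 : ∫ w in box ×ˢ {(0 : ℤ)}, (regRep c μ ν (incl c μ ν Φ) cyc : L2) w ∂measPZ
      = ∫ w in box ×ˢ {(0 : ℤ)}, Φ.1 (w.1, 0) ∂measPZ := by
    refine setIntegral_congr_ae measurable_box0 ?_
    have h2 : ∀ q : ℤ, ∀ᵐ w ∂measPZ, cyc (w.1, w.2 - q)
        = (box ×ˢ {(0 : ℤ)}).indicator (fun _ => (1 : ℂ)) (w.1, w.2 - q) := fun q =>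
      (measPreserving_shift q).quasiMeasurePreserving.ae indicatorConstLp_coeFn
    filter_upwards [regRep_incl_coe (μ := μ) Φ cyc, ae_all_iff.mpr h2] with w h3 h4 hw
    obtain ⟨z, p⟩ := w
    obtain ⟨hz, hp⟩ := hw
    rw [Set.mem_singleton_iff] at hp
    dsimp only at hp hz h3 h4
    subst hp
    rw [h3, finsum_eq_single _ 0]
    · rw [h4 0, lam_zero, Set.indicator_of_mem (by exact ⟨hz, by simp⟩), mul_one]
    · intro q hq
      rw [h4 q, Set.indicator_of_notMem, mul_zero]
      rintro ⟨-, h⟩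
      exact hq (by simpa using h)
  rw [h1, measPZ, ← Measure.prod_restrict, Measure.restrict_singleton, Measure.count_singleton,
    one_smul, Measure.prod_dirac, integral_map]
  · rfl
  · exact (measurable_id.prodMk measurable_const).aemeasurable
  · exact (Continuous.aestronglyMeasurable (by fun_prop))

theorem norm_trace0_le (Φ : D0 c ν) : ‖trace0 c ν Φ‖ ≤ ‖cyc‖ * ‖cyc‖ * ‖incl c μ ν Φ‖ := by
  rw [trace0_eq_inner (μ := μ)]
  calc _ ≤ ‖cyc‖ * ‖regRep c μ ν (incl c μ ν Φ) cyc‖ := norm_inner_le_norm _ _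
    _ ≤ ‖cyc‖ * (‖regRep c μ ν (incl c μ ν Φ)‖ * ‖cyc‖) := by
        gcongr; exact ContinuousLinearMap.le_opNorm _ _
    _ ≤ ‖cyc‖ * (‖incl c μ ν Φ‖ * ‖cyc‖) := by
        gcongr; exact NonUnitalStarAlgHom.norm_apply_le (regRep c μ ν) _
    _ = _ := by ring

/-- The continuous extension of a linear functional along a linear map with dense range. -/
def extendFunctional {E B : Type*} [AddCommGroup E] [Module ℂ E] [NormedRing B]
    [NormedAlgebra ℂ B]
    (f : E →ₗ[ℂ] ℂ) (i : E →ₗ[ℂ] B) : B →L[ℂ] ℂ :=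
  LinearMap.extendOfNorm (𝕜 := ℂ) (𝕜₂ := ℂ) (σ₁₂ := RingHom.id ℂ) (E := E) (Eₗ := B) (F := ℂ) f i

theorem extendFunctional_apply {E B : Type*} [AddCommGroup E] [Module ℂ E] [NormedRing B]
    [NormedAlgebra ℂ B]
    (f : E →ₗ[ℂ] ℂ) (i : E →ₗ[ℂ] B) (hi : DenseRange i) (C : ℝ) (hC : ∀ x, ‖f x‖ ≤ C * ‖i x‖)
    (x : E) : extendFunctional f i (i x) = f x :=
  LinearMap.extendOfNorm_eq (𝕜 := ℂ) (𝕜₂ := ℂ) (σ₁₂ := RingHom.id ℂ) (E := E) (Eₗ := B) (F := ℂ)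
    hi ⟨C, hC⟩ x

variable (c μ ν) in
/-- The trace `τ_D` on `D^c_{μν}`: the continuous extension of `Φ ↦ ∫_{𝕋²} Φ(x, y, 0) dx dy`. -/
def trace : D c μ ν →L[ℂ] ℂ := 
  extendFunctional (E := D0 c ν) (B := D c μ ν) (trace0 c ν) (incl c μ ν)

theorem trace0_apply (Φ : D0 c ν) : trace0 c ν Φ = ∫ z in box, Φ.1 (z, 0) := rfl

theorem trace_incl0 (Φ : D0 c ν) : trace c μ ν (incl c μ ν Φ) = trace0 c ν Φ := by
  rw [trace]
  have h1 : DenseRange (incl c μ ν) := incl_dense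
  have h2 : ∀ Φ : D0 c ν, ‖trace0 c ν Φ‖ ≤ ‖cyc‖ * ‖cyc‖ * ‖incl c μ ν Φ‖ := norm_trace0_le
  have h3 := extendFunctional_apply (E := D0 c ν) (B := D c μ ν) (trace0 c ν) (incl c μ ν)
  have h4 := h3 h1 (‖cyc‖ * ‖cyc‖)
  exact h4 h2 Φ

theorem trace_incl (Φ : D0 c ν) : trace c μ ν (incl c μ ν Φ) = ∫ z in box, Φ.1 (z, 0) := by
  rw [trace_incl0, trace0_apply]

variable (c ν) in
/-- The phase `e(c (4 p³ ν / 3 - p² y))`. -/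
def phase (w : Plane × ℤ) : ℂ :=
  e (((c * (4 * (w.2 : ℝ) ^ 3 * ν / 3) : ℝ) : UnitAddCircle) - (c * w.2 ^ 2 : ℤ) • w.1.2)

variable (c ν) in
/-- The phase `e(c (-4 p³ ν / 3 - p² y))`. -/
def phaseU (w : Plane × ℤ) : ℂ :=
  e (((c * (-(4 * (w.2 : ℝ) ^ 3 * ν / 3)) : ℝ) : UnitAddCircle) - (c * w.2 ^ 2 : ℤ) • w.1.2)

end QuantumHeisenberg

end QHM

end

/-! All the isomorphisms come from one principle. Suppose that a unitary `U` on `L²(ℝ × 𝕋 × ℤ)` and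
a surjection `j` between the function spaces satisfy `Π_Φ U = U Π'_{j Φ}`. Then the C*-algebras
`Π(D)` and `U Π'(D') U*` have a common dense subset, hence coincide. Once `Π` and `Π'` are known to
be faithful, `D` and `D'` are isomorphic, and the isomorphism extends `j`. It preserves the trace as
soon as `j` preserves the integral over degree `0` (`exists_starAlgEquiv_of_intertwine`).

The real work is faithfulness (`regRep_injective`), because `D` lives in the multipliers of the full
crossed product, whose norm involves every covariant representation. The argument is the usual one
for an amenable group, through the dual circle action. Replacing `V` by `e(θ) V` in a covariant
representation `R` gives representations `R_θ`, and averaging `⟨h, R_θ(a) h⟩` over `θ` leaves only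
the degree `0` part of `a`. For `Φ ∈ D₀` this part is a function, bounded in every `R` by its
supremum, and the supremum is at most `‖Π_Φ‖` (`norm_slice_zero_le`). By density `|∫ ⟨h, R_θ(a) h⟩
dθ| ≤ ‖h‖² ‖Π_a‖` on all of `D`. If `Π_a = 0`, this bound for `a* a` reads `∫ ‖R_θ(a) h‖² dθ = 0`;
by continuity `R_0(a) h = 0`, for all `R` and `h`, so `a = 0`.

For `ν ↦ ν + l`, neither the transformation rule nor `λ_p` changes, since only the class of an
integer multiple of `ν` in `𝕋` matters, so `U = 1` works. For `μ ↦ μ + 1`, the point `λ_p(x, y)`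
moves by the integer `2p` in the first coordinate, which costs the factor `e(-2cpq(y + 2pν - qν))`
in degree `q`. The two phases are made so that this factor is a coboundary (`D0_apply_lam_succ`).
General integer shifts are compositions of these. -/

noncomputable section

namespace QHM

/-! ### Twisting covariant representations by characters of `ℤ` -/

section Twist

variable {A : Type} [NonUnitalCStarAlgebra A] {α : A ≃⋆ₐ[ℂ] A}

/-- The unit complex number `e(θ)` as a unitary. -/
def unitaryE (θ : UnitAddCircle) : unitary ℂ :=
  ⟨e θ, by
    have h : star (e θ) * e θ = 1 := by rw [star_e, ← e_add, neg_add_cancel, e_zero]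
    exact Unitary.mem_iff.mpr ⟨h, by rw [mul_comm, h]⟩⟩

/-- The covariant representation `(π, e(θ) V)`. -/
def CovRep.twist (R : CovRep α) (θ : UnitAddCircle) : CovRep α where
  H := R.H
  π := R.π
  nondeg := R.nondeg
  V := unitaryE θ • R.V
  cov a := by
    change (e θ • (R.V : R.H →L[ℂ] R.H)) * R.π a = R.π (α a) * (e θ • (R.V : R.H →L[ℂ] R.H))
    rw [smul_mul_assoc, mul_smul_comm, R.cov]

theorem CovRep.twist_zero (R : CovRep α) : R.twist 0 = R := by
  obtain ⟨H, π, nd, V, cov⟩ := R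
  have : unitaryE 0 • V = V := Subtype.ext (by
    change e 0 • (V : H →L[ℂ] H) = _
    rw [e_zero, one_smul])
  simp only [CovRep.twist, this]

theorem unitaryE_zsmul (p : ℤ) (θ : UnitAddCircle) : unitaryE (p • θ) = unitaryE θ ^ p := by
  have hadd : ∀ s t, unitaryE (s + t) = unitaryE s * unitaryE t := fun s t =>
    Subtype.ext (e_add s t)
  let f : Multiplicative UnitAddCircle →* unitary ℂ :=
    MonoidHom.mk' (fun t => unitaryE t.toAdd) fun s t => hadd _ _
  exact map_zpow f (Multiplicative.ofAdd θ) p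

theorem unitary_smul_zpow {B : Type*} [Ring B] [StarRing B] [Algebra ℂ B] [StarModule ℂ B]
    (u : unitary ℂ) (V : unitary B) (p : ℤ) : (u • V) ^ p = u ^ p • V ^ p := by
  let f : unitary ℂ →* unitary B := MonoidHom.mk' (fun u => u • 1) fun u v => Subtype.ext (by
    change ((u : ℂ) * (v : ℂ)) • (1 : B) = ((u : ℂ) • (1 : B)) * ((v : ℂ) • (1 : B))
    rw [smul_mul_smul_comm, one_mul])
  have hf : ∀ (u : unitary ℂ) (V : unitary B), u • V = f u * V := fun u V => Subtype.ext (by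
    change (u : ℂ) • (V : B) = ((u : ℂ) • (1 : B)) * (V : B)
    rw [smul_one_mul])
  have hc : Commute (f u) V := Subtype.ext (by
    change ((u : ℂ) • (1 : B)) * (V : B) = (V : B) * ((u : ℂ) • (1 : B))
    rw [smul_one_mul, mul_smul_one])
  rw [hf, hf, hc.mul_zpow, map_zpow]

/-- The `p`-th power of `e(θ) V` carries the scalar `e(pθ)`, the Fourier mode that later separates
the degrees. -/
theorem CovRep.twist_V_zpow (R : CovRep α) (θ : UnitAddCircle) (p : ℤ) :
    (((R.twist θ).V ^ p : unitary _) : (R.twist θ).H →L[ℂ] (R.twist θ).H)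
      = fourier p θ • ((R.V ^ p : unitary _) : R.H →L[ℂ] R.H) := by
  change (((unitaryE θ • R.V) ^ p : unitary (R.H →L[ℂ] R.H)) : R.H →L[ℂ] R.H) = _
  rw [unitary_smul_zpow, ← unitaryE_zsmul]
  rfl

variable (α) in
/-- The representation of the multiplier algebra given by `(π, e(θ) V)`. -/
def CovRep.twistRep (R : CovRep α) (θ : UnitAddCircle) : MultAlg α →⋆ₐ[ℂ] (R.H →L[ℂ] R.H) :=
  CovRep.multRep α (R.twist θ)

theorem CovRep.twistRep_zero (R : CovRep α) : CovRep.twistRep α R 0 = CovRep.multRep α R := by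
  -- The two sides are typed over `R.twist 0` and `R`; their Hilbert spaces agree by definition, so
  -- a heterogeneous equality transported along `twist_zero` becomes an honest one.
  have h : ∀ R' : CovRep α, R' = R → HEq (CovRep.multRep α R') (CovRep.multRep α R) := by
    rintro _ rfl
    exact HEq.rfl
  exact eq_of_heq (h _ R.twist_zero)

/-- The twist leaves `π` alone, hence also the operators of coefficient multipliers; only the shift
picks up a scalar. This is homogeneity of degree `p` under the circle action. -/
theorem CovRep.twistRep_coeff_mul_shift (R : CovRep α) (θ : UnitAddCircle) (m : 𝓜(ℂ, A))
    (p : ℤ) :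
    CovRep.twistRep α R θ (coeffMult α m * shiftMult α p)
      = fourier p θ • CovRep.multRep α R (coeffMult α m * shiftMult α p) := by
  rw [map_mul, map_mul, coeffMult, shiftMult, CovRep.multRep_multOf, CovRep.multRep_multOf,
    ← mul_smul_comm]
  change CovRep.multRep α (R.twist θ) _ * CovRep.multRep α (R.twist θ) _ = _
  rw [CovRep.multRep_multOf, CovRep.multRep_multOf]
  exact congrArg ((coeffOp m : BigAlg α).comp R * ·) (R.twist_V_zpow θ p)

/-- The covariant representations separate the multipliers of the crossed product. -/
theorem multAlg_eq_zero {a : MultAlg α} (h : ∀ R : CovRep α, CovRep.multRep α R a = 0) : a = 0 :=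
  multAlg_ext fun x => Subtype.ext (bigAlg_ext fun R => by
    -- `R(a) R(x) = R(a x)`, so all components of `a x` vanish; an element of the crossed product is
    -- determined by its components.
    have h1 := extendRep_mul (A := crossedProduct α) R.integrated_nondeg a x
    have h2 : extendRep (A := crossedProduct α) (CovRep.integrated α R) R.integrated_nondeg a = 0 :=
      h R
    rw [h2, zero_mul] at h1
    exact h1.symm)

end Twist

/-! ### Averaging over the circle and faithfulness of the regular representation -/

/-- A suitable half-period translation changes the sign of a nontrivial character, and Haar measure
is translation invariant. -/
theorem integral_fourier {n : ℤ} (hn : n ≠ 0) : ∫ θ : UnitAddCircle, fourier n θ = 0 :=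
  integral_eq_zero_of_add_right_eq_neg (fourier_add_half_inv_index hn one_pos)

variable {c : ℕ} {μ ν : ℝ}

/-- In degree `0` the shift is `1`, so only the multiplier `φ` remains; its norm is at most `C` and
representations are contractive. The bound does not depend on `R`. -/
theorem multRep_homMult_zero_norm_le (R : CovRep (autom μ ν)) (φ : Plane →ᵇ ℂ) {C : ℝ}
    (hC : 0 ≤ C) (hφ : ∀ z, ‖φ z‖ ≤ C) :
    ‖CovRep.multRep (autom μ ν) R (homMult μ φ 0)‖ ≤ C := by
  rw [homMult, shiftMult_zero, mul_one, coeffMult, CovRep.multRep_multOf]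
  change ‖extendRep R.π R.nondeg (funMult φ)‖ ≤ C
  refine (NonUnitalStarAlgHom.norm_apply_le _ _).trans ?_
  rw [← DoubleCentralizer.norm_fst]
  refine ContinuousLinearMap.opNorm_le_bound _ hC fun f => (norm_mulC0_le φ f).trans ?_
  gcongr
  exact (BoundedContinuousFunction.norm_le hC).mpr hφ

/-- The function `θ ↦ ⟨h, R_θ(a) h⟩` for the twists `R_θ` of a covariant representation. -/
def gaugeCoeff (R : CovRep (autom μ ν)) (h : R.H) (a : D c μ ν) (θ : UnitAddCircle) : ℂ :=
  inner ℂ h (CovRep.twistRep (autom μ ν) R θ (D.toMultAlg c μ ν a) h)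

theorem gaugeCoeff_sub (R : CovRep (autom μ ν)) (h : R.H) (a b : D c μ ν) (θ : UnitAddCircle) :
    gaugeCoeff R h (a - b) θ = gaugeCoeff R h a θ - gaugeCoeff R h b θ := by
  rw [gaugeCoeff, map_sub, map_sub, sub_apply, inner_sub_right]
  rfl

theorem norm_gaugeCoeff_le (R : CovRep (autom μ ν)) (h : R.H) (a : D c μ ν) (θ : UnitAddCircle) :
    ‖gaugeCoeff R h a θ‖ ≤ ‖h‖ ^ 2 * ‖a‖ := by
  let T : R.H →L[ℂ] R.H := CovRep.twistRep (autom μ ν) R θ (D.toMultAlg c μ ν a)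
  have hT : ‖T‖ ≤ ‖a‖ :=
    NonUnitalStarAlgHom.norm_apply_le (CovRep.twistRep (autom μ ν) R θ) _
  calc ‖inner ℂ h (T h)‖ ≤ ‖h‖ * ‖T h‖ := norm_inner_le_norm _ _
    _ ≤ ‖h‖ * (‖a‖ * ‖h‖) := by gcongr; exact T.le_of_opNorm_le hT h
    _ = _ := by ring

/-- On `D₀` the gauge coefficient is a trigonometric polynomial in `θ`, with one mode for each
degree. -/
theorem gaugeCoeff_incl (R : CovRep (autom μ ν)) (h : R.H) (Φ : D0 c ν) (s : Finset ℤ)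
    (hs : ∀ q ∉ s, slice Φ q = 0) (θ : UnitAddCircle) :
    gaugeCoeff R h (incl c μ ν Φ) θ = ∑ q ∈ s, fourier q θ *
      inner ℂ h (CovRep.multRep (autom μ ν) R (homMult μ (slice Φ q) q) h) := by
  have h1 : CovRep.twistRep (autom μ ν) R θ (toMult c μ ν Φ)
      = ∑ q ∈ s, fourier q θ • CovRep.multRep (autom μ ν) R (homMult μ (slice Φ q) q) := by
    rw [toMult_eq_sum Φ s hs, map_sum]
    exact Finset.sum_congr rfl fun q _ => R.twistRep_coeff_mul_shift θ _ _
  rw [gaugeCoeff, toMultAlg_incl, h1, sum_apply, inner_sum]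
  refine Finset.sum_congr rfl fun q _ => ?_
  rw [smul_apply, inner_smul_right]

/-- A uniform limit of trigonometric polynomials: `norm_gaugeCoeff_le` is uniform in `θ` and `D₀` is
dense. -/
theorem continuous_gaugeCoeff (R : CovRep (autom μ ν)) (h : R.H) (a : D c μ ν) :
    Continuous (gaugeCoeff R h a) := by
  refine continuous_of_uniform_approx_of_continuous fun u hu => ?_
  obtain ⟨ε, hε, hu⟩ := Metric.mem_uniformity_dist.mp hu
  -- The `+ 1` keeps the denominator positive when `h = 0`.
  have hd : 0 < ε / (‖h‖ ^ 2 + 1) := by positivity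
  obtain ⟨Φ, hΦ⟩ := incl_dense.exists_dist_lt a hd
  obtain ⟨s, hs⟩ := slice_zero_of Φ
  refine ⟨gaugeCoeff R h (incl c μ ν Φ), ?_, fun θ => hu ?_⟩
  · rw [funext (gaugeCoeff_incl R h Φ s hs)]
    fun_prop
  · rw [dist_eq_norm, ← gaugeCoeff_sub]
    rw [dist_eq_norm, lt_div_iff₀ (by positivity)] at hΦ
    refine (norm_gaugeCoeff_le R h _ θ).trans_lt (lt_of_le_of_lt ?_ hΦ)
    nlinarith [norm_nonneg (a - incl c μ ν Φ)]

theorem integrable_gaugeCoeff (R : CovRep (autom μ ν)) (h : R.H) (a : D c μ ν) :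
    Integrable (gaugeCoeff R h a) :=
  (continuous_gaugeCoeff R h a).integrable_of_hasCompactSupport
    (HasCompactSupport.of_compactSpace _)

theorem integral_gaugeCoeff_incl (R : CovRep (autom μ ν)) (h : R.H) (Φ : D0 c ν) :
    ∫ θ, gaugeCoeff R h (incl c μ ν Φ) θ
      = inner ℂ h (CovRep.multRep (autom μ ν) R (homMult μ (slice Φ 0) 0) h) := by
  obtain ⟨s, hs⟩ := slice_zero_of Φ
  -- Degree `0` may lie outside `s`; adding it lets the surviving term be singled out in every case.
  have hs' : ∀ q ∉ insert 0 s, slice Φ q = 0 := fun q hq =>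
    hs q fun h => hq (Finset.mem_insert_of_mem h)
  rw [funext (gaugeCoeff_incl R h Φ _ hs'), integral_finsetSum]
  · rw [Finset.sum_eq_single_of_mem 0 (Finset.mem_insert_self _ _)]
    · simp [Measure.real]
    · intro q _ hq
      rw [integral_mul_const, integral_fourier hq, zero_mul]
  · intro q _
    exact Continuous.integrable_of_hasCompactSupport (by fun_prop)
      (HasCompactSupport.of_compactSpace _)

/-- The degree `0` part of `Φ` is bounded by the norm of `Π_Φ`. -/
theorem norm_slice_zero_le (Φ : D0 c ν) (z : Plane) :
    ‖slice Φ 0 z‖ ≤ ‖regRep c μ ν (incl c μ ν Φ)‖ := by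
  refine le_of_forall_pos_le_add fun ε hε => ?_
  -- The aim is an open `S ∋ z` on which `Φ(·, 0)` varies by less than `ε`; the compact `K` makes
  -- its measure finite.
  obtain ⟨K, hK, hKz⟩ := exists_compact_mem_nhds z
  have hnhds : K ∩ {w | ‖slice Φ 0 w - slice Φ 0 z‖ < ε} ∈ 𝓝 z := by
    refine inter_mem hKz (IsOpen.mem_nhds (isOpen_lt (by fun_prop) continuous_const) ?_)
    simpa using hε
  obtain ⟨S, hS, hSo, hzS⟩ := mem_nhds_iff.mp hnhds
  have hfin : volume S ≠ ∞ :=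
    ((measure_mono (hS.trans Set.inter_subset_left)).trans_lt hK.measure_lt_top).ne
  have hpos : 0 < volume.real S :=
    ENNReal.toReal_pos (hSo.measure_pos volume ⟨z, hzS⟩).ne' hfin
  have hm : MeasurableSet (S ×ˢ {(0 : ℤ)}) := hSo.measurableSet.prod (measurableSet_singleton 0)
  have hmeas : measPZ (S ×ˢ {(0 : ℤ)}) = volume S := by
    rw [measPZ, Measure.prod_prod]; simp
  have hmfin : measPZ (S ×ˢ {(0 : ℤ)}) ≠ ∞ := hmeas ▸ hfin
  -- The vector state of this `ξ`, divided by `‖ξ‖²`, is the mean over `S` of the degree `0` part,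
  -- which is nearly its value at `z`.
  let ξ : L2 := indicatorConstLp 2 hm hmfin 1
  have hξ : ‖ξ‖ * ‖ξ‖ = volume.real S := by
    have : ((‖ξ‖ * ‖ξ‖ : ℝ) : ℂ) = (volume.real S : ℝ) := by
      rw [← pow_two, Complex.ofReal_pow]
      refine (inner_self_eq_norm_sq_to_K (𝕜 := ℂ) ξ).symm.trans ?_
      rw [L2.inner_indicatorConstLp_one, setIntegral_congr_ae (g := fun _ => (1 : ℂ)) hm]
      · simp [Measure.real, hmeas]
      · filter_upwards [indicatorConstLp_coeFn (p := 2) (hs := hm) (hμs := hmfin) (c := (1 : ℂ))]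
          with w h1 h2
        rw [h1, Set.indicator_of_mem h2]
    exact_mod_cast this
  have hin : inner ℂ ξ (regRep c μ ν (incl c μ ν Φ) ξ) = ∫ w in S, slice Φ 0 w := by
    rw [L2.inner_indicatorConstLp_one]
    have h1 : ∫ w in S ×ˢ {(0 : ℤ)}, (regRep c μ ν (incl c μ ν Φ) ξ : L2) w ∂measPZ
        = ∫ w in S ×ˢ {(0 : ℤ)}, Φ.1 (w.1, 0) ∂measPZ := by
      refine setIntegral_congr_ae hm ?_
      have h2 : ∀ q : ℤ, ∀ᵐ w ∂measPZ, ξ (w.1, w.2 - q)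
          = (S ×ˢ {(0 : ℤ)}).indicator (fun _ => (1 : ℂ)) (w.1, w.2 - q) := fun q =>
        (measPreserving_shift q).quasiMeasurePreserving.ae indicatorConstLp_coeFn
      filter_upwards [regRep_incl_coe (μ := μ) Φ ξ, ae_all_iff.mpr h2] with w h3 h4 hw
      obtain ⟨z, p⟩ := w
      obtain ⟨hz, hp⟩ := hw
      rw [Set.mem_singleton_iff] at hp
      dsimp only at hp hz h3 h4
      subst hp
      -- On the fibre `p = 0` the shift by `q ≠ 0` reads `ξ` at `-q`, off its support; and `λ_0` is
      -- the identity.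
      rw [h3, finsum_eq_single _ 0]
      · rw [h4 0, lam_zero, Set.indicator_of_mem (by exact ⟨hz, by simp⟩), mul_one]
      · intro q hq
        rw [h4 q, Set.indicator_of_notMem, mul_zero]
        rintro ⟨-, h⟩
        exact hq (by simpa using h)
    rw [h1, measPZ, ← Measure.prod_restrict, Measure.restrict_singleton, Measure.count_singleton,
      one_smul, Measure.prod_dirac, integral_map]
    · rfl
    · exact (measurable_id.prodMk measurable_const).aemeasurable
    · exact (Continuous.aestronglyMeasurable (by fun_prop))
  have hb1 : ‖∫ w in S, slice Φ 0 w‖ ≤ ‖regRep c μ ν (incl c μ ν Φ)‖ * volume.real S := by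
    rw [← hin, ← hξ]
    calc _ ≤ ‖ξ‖ * ‖regRep c μ ν (incl c μ ν Φ) ξ‖ := norm_inner_le_norm _ _
      _ ≤ ‖ξ‖ * (‖regRep c μ ν (incl c μ ν Φ)‖ * ‖ξ‖) := by
          gcongr; exact ContinuousLinearMap.le_opNorm _ _
      _ = _ := by ring
  have hint : IntegrableOn (slice Φ 0) S := by
    have : IsFiniteMeasure ((volume : Measure Plane).restrict S) :=
      ⟨by rw [Measure.restrict_apply_univ]; exact hfin.lt_top⟩
    exact (slice Φ 0).integrable _
  have hb2 : ‖(∫ w in S, slice Φ 0 w) - volume.real S • slice Φ 0 z‖ ≤ ε * volume.real S := by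
    rw [← setIntegral_const, ← integral_sub hint (integrableOn_const hfin)]
    exact norm_setIntegral_le_of_norm_le_const hfin.lt_top fun w hw => (hS hw).2.le
  have hb3 : ‖volume.real S • slice Φ 0 z‖
      ≤ (‖regRep c μ ν (incl c μ ν Φ)‖ + ε) * volume.real S := by
    have := norm_sub_norm_le (volume.real S • slice Φ 0 z) (∫ w in S, slice Φ 0 w)
    rw [norm_sub_rev] at this
    linarith
  rw [norm_smul, Real.norm_of_nonneg hpos.le, mul_comm] at hb3
  exact le_of_mul_le_mul_right hb3 hpos

/-- Both sides are continuous in `a`, so `D₀` suffices. There the integral sees only the degree `0`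
function, whose supremum `Π` controls. -/
theorem norm_integral_gaugeCoeff_le (R : CovRep (autom μ ν)) (h : R.H) (a : D c μ ν) :
    ‖∫ θ, gaugeCoeff R h a θ‖ ≤ ‖h‖ ^ 2 * ‖regRep c μ ν a‖ := by
  have hcont : Continuous fun a : D c μ ν => ∫ θ, gaugeCoeff R h a θ := by
    -- The circle has total mass `1`, so the pointwise bound on the gauge coefficient is itself a
    -- Lipschitz constant.
    refine (LipschitzWith.of_dist_le_mul (K := ⟨‖h‖ ^ 2, by positivity⟩) fun a b => ?_).continuous
    rw [dist_eq_norm, dist_eq_norm, ← integral_sub (integrable_gaugeCoeff R h a)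
      (integrable_gaugeCoeff R h b)]
    refine (norm_integral_le_of_norm_le_const (C := ‖h‖ ^ 2 * ‖a - b‖)
      (Eventually.of_forall fun θ => ?_)).trans_eq ?_
    · rw [← gaugeCoeff_sub]; exact norm_gaugeCoeff_le R h _ θ
    · simp only [Measure.real, UnitAddCircle.measure_univ, ENNReal.toReal_one, mul_one]
      rfl
  have hreg : Continuous (regRep c μ ν) :=
    AddMonoidHomClass.continuous_of_bound (regRep c μ ν) 1 fun a => by
      simpa using NonUnitalStarAlgHom.norm_apply_le (regRep c μ ν) a
  refine incl_dense.induction_on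
    (p := fun a => ‖∫ θ, gaugeCoeff R h a θ‖ ≤ ‖h‖ ^ 2 * ‖regRep c μ ν a‖) a
    (isClosed_le hcont.norm (hreg.norm.const_mul _)) fun Φ => ?_
  rw [integral_gaugeCoeff_incl]
  calc _ ≤ ‖h‖ * ‖CovRep.multRep (autom μ ν) R (homMult μ (slice Φ 0) 0) h‖ :=
        norm_inner_le_norm _ _
    _ ≤ ‖h‖ * (‖regRep c μ ν (incl c μ ν Φ)‖ * ‖h‖) := by
        gcongr
        exact ContinuousLinearMap.le_of_opNorm_le _
          (multRep_homMult_zero_norm_le R _ (norm_nonneg _) (norm_slice_zero_le Φ)) h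
    _ = _ := by ring

/-- The regular representation is faithful on `D^c_{μν}`. -/
theorem regRep_injective : Function.Injective (regRep c μ ν) := by
  rw [injective_iff_map_eq_zero]
  intro a ha
  refine Subtype.ext (multAlg_eq_zero fun R => ContinuousLinearMap.ext fun h => ?_)
  let T (θ : UnitAddCircle) : R.H →L[ℂ] R.H :=
    CovRep.twistRep (autom μ ν) R θ (D.toMultAlg c μ ν a)
  have hT : ∀ θ, gaugeCoeff R h (star a * a) θ = ((‖T θ h‖ ^ 2 : ℝ) : ℂ) := by
    intro θ
    have h1 : CovRep.twistRep (autom μ ν) R θ (D.toMultAlg c μ ν (star a * a))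
        = star (T θ) * T θ := by
      rw [map_mul, map_mul, map_star, map_star]
    rw [gaugeCoeff, h1, mul_apply_eq_comp, ContinuousLinearMap.star_eq_adjoint,
      ContinuousLinearMap.adjoint_inner_right, inner_self_eq_norm_sq_to_K,
      Complex.ofReal_pow]
    rfl
  have hcont : Continuous fun θ => ‖T θ h‖ ^ 2 := by
    have := Complex.continuous_re.comp (continuous_gaugeCoeff R h (star a * a))
    rw [funext hT] at this
    exact this
  have h0 : ∫ θ, ‖T θ h‖ ^ 2 = 0 := by
    -- `Π_{a* a} = Π_{a*} Π_a = 0`, so the averaged coefficient vanishes.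
    have h1 := norm_integral_gaugeCoeff_le R h (star a * a)
    rw [map_mul, ha, mul_zero, norm_zero, mul_zero, norm_le_zero_iff, funext hT] at h1
    exact Complex.ofReal_eq_zero.mp (integral_ofReal.symm.trans h1)
  rw [integral_eq_zero_iff_of_nonneg (fun θ => by positivity)
    (hcont.integrable_of_hasCompactSupport (HasCompactSupport.of_compactSpace _))] at h0
  -- A continuous function that vanishes almost everywhere vanishes at every point, in particular at
  -- `θ = 0`, where the twist is trivial.
  have h1 := congrFun ((hcont.ae_eq_iff_eq volume continuous_zero).mp h0) 0
  have h2 : T 0 h = 0 := by simpa using h1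
  rw [← R.twistRep_zero]
  exact h2

/-! ### Isomorphisms implemented by intertwining unitaries -/

/-- Two faithful representations with the same range define an isomorphism. -/
theorem exists_starAlgEquiv_of_range_eq {A A' B : Type*} [CStarAlgebra A] [CStarAlgebra A']
    [CStarAlgebra B] (ρ : A →⋆ₐ[ℂ] B) (ρ' : A' →⋆ₐ[ℂ] B) (hρ : Function.Injective ρ)
    (hρ' : Function.Injective ρ') (h : ∀ a, ∃ b, ρ' b = ρ a) (h' : ∀ b, ∃ a, ρ a = ρ' b) :
    ∃ F : A ≃⋆ₐ[ℂ] A', ∀ a, ρ' (F a) = ρ a := by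
  choose f hf using h
  -- `f` is `ρ'⁻¹ ∘ ρ`; each algebraic law is checked after applying the injective `ρ'`.
  let F : A →⋆ₐ[ℂ] A' :=
    { toFun := f
      map_one' := hρ' (by rw [hf, map_one, map_one])
      map_mul' := fun a b => hρ' (by rw [hf, map_mul, map_mul, hf, hf])
      map_zero' := hρ' (by rw [hf, map_zero, map_zero])
      map_add' := fun a b => hρ' (by rw [hf, map_add, map_add, hf, hf])
      commutes' := fun r => hρ' (by rw [hf, AlgHomClass.commutes, AlgHomClass.commutes])
      map_star' := fun a => hρ' (by rw [hf, map_star, map_star, hf]) }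
  have hF : Function.Bijective F :=
    ⟨fun a b hab => hρ (by rw [← hf, ← hf]; exact congrArg ρ' hab), fun b => by
      obtain ⟨a, ha⟩ := h' b
      exact ⟨a, hρ' ((hf a).trans ha)⟩⟩
  exact ⟨StarAlgEquiv.ofBijective F hF, hf⟩

variable {μ' ν' : ℝ}

theorem isClosed_range_regRep : IsClosed (Set.range (regRep c μ ν)) :=
  (NonUnitalStarAlgHom.isometry (regRep c μ ν) regRep_injective).isClosedEmbedding.isClosed_range

theorem continuous_regRep : Continuous (regRep c μ ν) :=
  (NonUnitalStarAlgHom.isometry (regRep c μ ν) regRep_injective).continuous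

/-- A unitary that intertwines the regular representations on `D₀`, up to a bijection of the
function spaces, implements an isomorphism. -/
theorem exists_starAlgEquiv_of_intertwine (U : unitary (L2 →L[ℂ] L2)) (j : D0 c ν → D0 c ν')
    (hj : Function.Surjective j)
    (h : ∀ Φ, regRep c μ ν (incl c μ ν Φ) * (U : L2 →L[ℂ] L2)
      = (U : L2 →L[ℂ] L2) * regRep c μ' ν' (incl c μ' ν' (j Φ)))
    (ht : ∀ Φ, trace0 c ν' (j Φ) = trace0 c ν Φ) :
    ∃ F : D c μ ν ≃⋆ₐ[ℂ] D c μ' ν', (∀ Φ, F (incl c μ ν Φ) = incl c μ' ν' (j Φ)) ∧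
      (∀ a, trace c μ' ν' (F a) = trace c μ ν a) ∧
      ∀ a, regRep c μ ν a * (U : L2 →L[ℂ] L2) = (U : L2 →L[ℂ] L2) * regRep c μ' ν' (F a) := by
  let conj : (L2 →L[ℂ] L2) ≃⋆ₐ[ℂ] (L2 →L[ℂ] L2) := Unitary.conjStarAlgAut ℂ _ U
  have hconj : ∀ S T, conj S = T ↔ T * (U : L2 →L[ℂ] L2) = (U : L2 →L[ℂ] L2) * S := by
    intro S T
    rw [Unitary.conjStarAlgAut_apply]
    constructor
    · rintro rfl
      rw [mul_assoc, Unitary.star_mul_self_of_mem U.2, mul_one]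
    · intro h
      rw [← h, mul_assoc, Unitary.mul_star_self_of_mem U.2, mul_one]
  let ρ' : D c μ' ν' →⋆ₐ[ℂ] (L2 →L[ℂ] L2) := (conj : _ →⋆ₐ[ℂ] _).comp (regRep c μ' ν')
  have hρ'j : ∀ Φ, ρ' (incl c μ' ν' (j Φ)) = regRep c μ ν (incl c μ ν Φ) := fun Φ =>
    (hconj _ _).mpr (h Φ)
  have hinj : Function.Injective ρ' := conj.injective.comp regRep_injective
  have hiso : Isometry ρ' := NonUnitalStarAlgHom.isometry ρ' hinj
  -- Faithful representations are isometric, so both ranges are closed, and each contains the image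
  -- of the other's `D₀`. Surjectivity of `j` is needed for the second inclusion.
  obtain ⟨F, hF⟩ := exists_starAlgEquiv_of_range_eq (regRep c μ ν) ρ' regRep_injective hinj
    (fun a => incl_dense.induction_on (p := fun a => regRep c μ ν a ∈ Set.range ρ') a
      (hiso.isClosedEmbedding.isClosed_range.preimage continuous_regRep)
      fun Φ => ⟨_, hρ'j Φ⟩)
    (fun b => incl_dense.induction_on (p := fun b => ρ' b ∈ Set.range (regRep c μ ν)) b
      (isClosed_range_regRep.preimage hiso.continuous)
      fun Ψ => by
        obtain ⟨Φ, rfl⟩ := hj Ψ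
        exact ⟨_, (hρ'j Φ).symm⟩)
  have hincl : ∀ Φ, F (incl c μ ν Φ) = incl c μ' ν' (j Φ) := fun Φ =>
    hinj ((hF _).trans (hρ'j Φ).symm)
  have hFc : Continuous F := (NonUnitalStarAlgHom.isometry F F.injective).continuous
  refine ⟨F, hincl, fun a => ?_, fun a => (hconj _ _).mp (hF a)⟩
  refine incl_dense.induction_on (p := fun a => trace c μ' ν' (F a) = trace c μ ν a) a
    (isClosed_eq ((trace c μ' ν').continuous.comp hFc) (trace c μ ν).continuous) fun Φ => ?_
  rw [hincl, trace_incl0, trace_incl0, ht]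

/-! ### Integer shifts of `ν` -/

theorem quasi_add_intCast {l p : ℤ} {φ : Plane → ℂ} (h : Quasi c ν p φ) :
    Quasi c (ν + l) p φ := by
  intro k x y
  rw [h k x y]
  congr 3
  have : ((p * (ν + l) : ℝ) : UnitAddCircle) = ((p * ν : ℝ) : UnitAddCircle) := by
    have h : (((p * l : ℤ) : ℝ) : UnitAddCircle) = 0 :=
      (AddCircle.coe_eq_zero_iff 1).mpr ⟨p * l, by simp⟩
    rw [mul_add, AddCircle.coe_add, ← Int.cast_mul, h, add_zero]
  rw [this]

theorem D0_le_add_intCast (l : ℤ) : D0 c ν ≤ D0 c (ν + l) := fun _ hΦ =>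
  ⟨hΦ.1, fun p => quasi_add_intCast (hΦ.2 p)⟩

/-- The inclusion for `-l`, started at `ν + l`. -/
theorem D0_add_intCast_le (l : ℤ) : D0 c (ν + l) ≤ D0 c ν := by
  simpa using D0_le_add_intCast (c := c) (ν := ν + l) (-l)

theorem lam_add_intCast (l p : ℤ) (z : Plane) : lam μ (ν + l) p z = lam μ ν p z := by
  obtain ⟨x, y⟩ := z
  have h : (((2 * p * l : ℤ) : ℝ) : UnitAddCircle) = 0 :=
    (AddCircle.coe_eq_zero_iff 1).mpr ⟨2 * p * l, by simp⟩
  have h2 : (2 * p * (ν + l) : ℝ) = 2 * p * ν + ((2 * p * l : ℤ) : ℝ) := by push_cast; ring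
  rw [lam_apply, lam_apply, h2, AddCircle.coe_add, h, add_zero]

theorem exists_starAlgEquiv_add_intCast_right (l : ℤ) :
    ∃ F : D c μ ν ≃⋆ₐ[ℂ] D c μ (ν + l),
      (∀ (Φ : C(Plane × ℤ, ℂ)) (hΦ : Φ ∈ D0 c ν), ∃ hΦ' : Φ ∈ D0 c (ν + l),
        F (incl c μ ν ⟨Φ, hΦ⟩) = incl c μ (ν + l) ⟨Φ, hΦ'⟩) ∧
      ∀ a, trace c μ (ν + l) (F a) = trace c μ ν a := by
  obtain ⟨F, hF, ht, -⟩ := exists_starAlgEquiv_of_intertwine (c := c) (μ := μ) (ν := ν) (μ' := μ)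
    (ν' := ν + l) 1
    (fun Φ => ⟨Φ.1, D0_le_add_intCast l Φ.2⟩) (fun Ψ => ⟨⟨Ψ.1, D0_add_intCast_le l Ψ.2⟩, rfl⟩)
    (fun Φ => by
      rw [OneMemClass.coe_one, mul_one, one_mul]
      refine ContinuousLinearMap.ext fun ξ => Lp.ext ?_
      filter_upwards [regRep_incl_coe (μ := μ) Φ ξ,
        regRep_incl_coe (μ := μ) (⟨Φ.1, D0_le_add_intCast l Φ.2⟩ : D0 c (ν + l)) ξ] with w h1 h2
      rw [h1, h2]
      simp only [lam_add_intCast])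
    (fun Φ => rfl)
  exact ⟨F, fun Φ hΦ => ⟨D0_le_add_intCast l hΦ, hF ⟨Φ, hΦ⟩⟩, ht⟩

/-! ### The shift of `μ` by `1` -/

theorem norm_phase (w : Plane × ℤ) : ‖phase c ν w‖ = 1 := norm_e _

theorem norm_phaseU (w : Plane × ℤ) : ‖phaseU c ν w‖ = 1 := norm_e _

theorem continuous_phase : Continuous (phase c ν) := by
  rw [continuous_prod_of_discrete_right]
  intro p
  exact continuous_e.comp (by fun_prop)

theorem continuous_phaseU : Continuous (phaseU c ν) := by
  rw [continuous_prod_of_discrete_right]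
  intro p
  exact continuous_e.comp (by fun_prop)

theorem star_mul_self_of_norm_eq_one {z : ℂ} (h : ‖z‖ = 1) : star z * z = 1 := by
  have := Complex.conj_mul' z
  rw [h] at this
  simpa using this

/-- Multiplication by a function that depends on `y` and `p` only. -/
def mulD0 (u : C(Plane × ℤ, ℂ)) (hu : ∀ (x x' : ℝ) (y : UnitAddCircle) (p : ℤ),
    u ((x, y), p) = u ((x', y), p)) (Φ : D0 c ν) : D0 c ν :=
  ⟨u * Φ.1, ⟨by
    obtain ⟨s, hs⟩ := Φ.2.1
    exact ⟨s, fun z p hp => by rw [ContinuousMap.mul_apply, hs z p hp, mul_zero]⟩,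
    fun p k x y => by
      have h := Φ.2.2 p k x y
      dsimp only at h ⊢
      -- Independence of `x` is what lets the factor pass through the transformation rule.
      rw [ContinuousMap.mul_apply, ContinuousMap.mul_apply, h, hu (x + k) x]
      ring⟩⟩

variable (c ν) in
/-- Multiplication by the phase `e(c (4 p³ ν / 3 - p² y))` on `D₀`. -/
def phaseMul : D0 c ν → D0 c ν := mulD0 ⟨phase c ν, continuous_phase⟩ fun _ _ _ _ => rfl

theorem phaseMul_apply (Φ : D0 c ν) (w : Plane × ℤ) :
    (phaseMul c ν Φ).1 w = phase c ν w * Φ.1 w := rfl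

theorem phaseMul_surjective : Function.Surjective (phaseMul c ν) := fun Ψ =>
  ⟨mulD0 ⟨fun w => star (phase c ν w), continuous_phase.star⟩ (fun _ _ _ _ => rfl) Ψ,
    Subtype.ext (ContinuousMap.ext fun w => by
      change phase c ν w * (star (phase c ν w) * Ψ.1 w) = Ψ.1 w
      rw [← mul_assoc, mul_comm (phase c ν w), star_mul_self_of_norm_eq_one (norm_phase w),
        one_mul])⟩

variable (c ν) in
/-- The phase `e(c (-4 p³ ν / 3 - p² y))` as a bounded continuous function. -/
def phaseUFun : (Plane × ℤ) →ᵇ ℂ :=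
  BoundedContinuousFunction.ofNormedAddCommGroup (phaseU c ν) continuous_phaseU 1
    fun w => (norm_phaseU w).le

theorem mulOp_one : mulOp 1 = 1 :=
  ContinuousLinearMap.ext fun ξ => Lp.ext (by
    filter_upwards [mulOp_coe 1 ξ] with w h
    rw [h]
    exact one_mul _)

variable (c ν) in
/-- Multiplication by the phase `e(c (-4 p³ ν / 3 - p² y))` on `L²(ℝ × 𝕋 × ℤ)`. -/
def phaseUnitary : unitary (L2 →L[ℂ] L2) :=
  ⟨mulOp (phaseUFun c ν), by
    have h : star (phaseUFun c ν) * phaseUFun c ν = 1 := by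
      ext w
      exact star_mul_self_of_norm_eq_one (norm_phaseU w)
    rw [Unitary.mem_iff, ← mulOp_star, ← mulOp_mul, ← mulOp_mul, mul_comm (phaseUFun c ν), h,
      mulOp_one]
    exact ⟨rfl, rfl⟩⟩

theorem phaseUnitary_coe (ξ : L2) :
    (phaseUnitary c ν : L2 →L[ℂ] L2) ξ =ᵐ[measPZ] fun w => phaseU c ν w * ξ w :=
  mulOp_coe (phaseUFun c ν) ξ

/-- The cocycle identity behind `J` and `U`. After the common factors are removed, the coefficients
of `cy` agree because `-2pq - (p - q)² = -p² - q²`. Those of `cν` agree because `-4p²q + 2pq² - 4(p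
- q)³/3 = -4p³/3 + 4q³/3 - 2pq²`; the last term comes from the phase of `J` evaluated at `y + 2pν`,
and the coefficient `4/3` is what cancels `p²q`. -/
theorem D0_apply_lam_succ (Φ : D0 c ν) (z : Plane) (p q : ℤ) :
    Φ.1 (lam (μ + 1) ν p z, q) * phaseU c ν (z, p - q)
      = phaseU c ν (z, p) * (phase c ν (lam μ ν p z, q) * Φ.1 (lam μ ν p z, q)) := by
  obtain ⟨x, y⟩ := z
  -- Raising `μ` by `1` moves the first coordinate by `2p`, so the rule is used with `k = 2p`.
  have h := Φ.2.2 q (2 * p) (x + 2 * p * μ) (y + ((2 * p * ν : ℝ) : UnitAddCircle))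
  have hx : x + 2 * p * (μ + 1) = x + 2 * p * μ + ((2 * p : ℤ) : ℝ) := by push_cast; ring
  dsimp only at h
  rw [lam_apply, lam_apply, hx, h, mul_right_comm, ← mul_assoc (phaseU c ν _)]
  congr 1
  rw [phaseU, phaseU, phase, ← e_add, ← e_add]
  congr 1
  -- With a real representative of `y`, the exponents agree already in `ℝ`.
  induction y using QuotientAddGroup.induction_on with
  | H y =>
    simp only [← AddCircle.coe_sub, ← AddCircle.coe_add, ← AddCircle.coe_zsmul,
      ← AddCircle.coe_neg]
    congr 1
    simp only [zsmul_eq_mul]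
    push_cast
    ring

/-- Both sides are sums over `q` of terms in `ξ(z, p - q)`; the cocycle identity matches them term
by term. -/
theorem regRep_mul_phaseUnitary (Φ : D0 c ν) :
    regRep c (μ + 1) ν (incl c (μ + 1) ν Φ) * (phaseUnitary c ν : L2 →L[ℂ] L2)
      = (phaseUnitary c ν : L2 →L[ℂ] L2) * regRep c μ ν (incl c μ ν (phaseMul c ν Φ)) := by
  refine ContinuousLinearMap.ext fun ξ => Lp.ext ?_
  rw [mul_apply_eq_comp, mul_apply_eq_comp]
  have h0 : ∀ q : ℤ, ∀ᵐ w ∂measPZ, (phaseUnitary c ν : L2 →L[ℂ] L2) ξ (w.1, w.2 - q)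
      = phaseU c ν (w.1, w.2 - q) * ξ (w.1, w.2 - q) := fun q =>
    (measPreserving_shift q).quasiMeasurePreserving.ae (phaseUnitary_coe ξ)
  filter_upwards [regRep_incl_coe (μ := μ + 1) Φ ((phaseUnitary c ν : L2 →L[ℂ] L2) ξ),
    regRep_incl_coe (μ := μ) (phaseMul c ν Φ) ξ, ae_all_iff.mpr h0,
    phaseUnitary_coe (c := c) (ν := ν) (regRep c μ ν (incl c μ ν (phaseMul c ν Φ)) ξ)]
    with w h1 h2 h3 h4
  rw [h1, h4, h2, mul_finsum]
  refine finsum_congr fun q => ?_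
  rw [h3, ← mul_assoc, D0_apply_lam_succ, phaseMul_apply]
  ring

theorem exists_starAlgEquiv_add_one_left :
    ∃ J : D c (μ + 1) ν ≃⋆ₐ[ℂ] D c μ ν,
      (∀ Φ, J (incl c (μ + 1) ν Φ) = incl c μ ν (phaseMul c ν Φ)) ∧
      (∀ a, trace c μ ν (J a) = trace c (μ + 1) ν a) ∧
      ∀ a, regRep c (μ + 1) ν a * (phaseUnitary c ν : L2 →L[ℂ] L2)
        = (phaseUnitary c ν : L2 →L[ℂ] L2) * regRep c μ ν (J a) :=
  exists_starAlgEquiv_of_intertwine (phaseUnitary c ν) (phaseMul c ν) phaseMul_surjective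
    regRep_mul_phaseUnitary fun Φ => by
      rw [trace0_apply, trace0_apply]
      congr 1
      funext z
      rw [phaseMul_apply]
      -- The trace sees only `p = 0`, where the phase is `1`.
      simp [phase, e_zero]

/-! ### Composition of the unit shifts -/

variable (c) in
/-- Existence of a trace-preserving *-isomorphism between two quantum Heisenberg manifolds. -/
def TraceIso (μ ν μ' ν' : ℝ) : Prop :=
  ∃ F : D c μ ν ≃⋆ₐ[ℂ] D c μ' ν', ∀ a, trace c μ' ν' (F a) = trace c μ ν a

theorem TraceIso.symm (h : TraceIso c μ ν μ' ν') : TraceIso c μ' ν' μ ν := by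
  obtain ⟨F, hF⟩ := h
  exact ⟨F.symm, fun a => by rw [← hF, StarAlgEquiv.apply_symm_apply]⟩

theorem TraceIso.trans {μ'' ν'' : ℝ} (h : TraceIso c μ ν μ' ν')
    (h' : TraceIso c μ' ν' μ'' ν'') : TraceIso c μ ν μ'' ν'' := by
  obtain ⟨F, hF⟩ := h
  obtain ⟨G, hG⟩ := h'
  exact ⟨F.trans G, fun a => by rw [StarAlgEquiv.trans_apply, hG, hF]⟩

theorem traceIso_add_one_left : TraceIso c μ ν (μ + 1) ν := by
  obtain ⟨J, -, hJ, -⟩ := exists_starAlgEquiv_add_one_left (c := c) (μ := μ) (ν := ν)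
  exact TraceIso.symm ⟨J, hJ⟩

theorem traceIso_add_intCast_left (k : ℤ) : TraceIso c μ ν (μ + k) ν := by
  induction k with
  | zero => rw [Int.cast_zero, add_zero]; exact ⟨StarAlgEquiv.refl ℂ _, fun a => rfl⟩
  | succ n ih =>
    rw [Int.cast_add, Int.cast_one, ← add_assoc]
    exact ih.trans traceIso_add_one_left
  | pred n ih =>
    refine ih.trans (TraceIso.symm ?_)
    -- `μ - n` is the unit shift of `μ - n - 1`, so the step is the inverse of the isomorphism for
    -- that shift.
    have h : μ + ((-(n : ℤ) : ℤ) : ℝ) = μ + ((-(n : ℤ) - 1 : ℤ) : ℝ) + 1 := by push_cast; ring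
    rw [h]
    exact traceIso_add_one_left

theorem traceIso_add_intCast (k l : ℤ) : TraceIso c μ ν (μ + k) (ν + l) := by
  obtain ⟨F, -, hF⟩ := exists_starAlgEquiv_add_intCast_right (c := c) (μ := μ + k) (ν := ν) l
  exact (traceIso_add_intCast_left k).trans ⟨F, hF⟩

end QHM

end

theorem mainTheorem3 (c : ℕ) (hc : 0 < c) (μ ν : ℝ) :
    -- a trace-preserving *-isomorphism for all integer shifts of the parameters
    (∀ k l : ℤ, ∃ F : QHM.D c μ ν ≃⋆ₐ[ℂ] QHM.D c (μ + k) (ν + l),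
      ∀ a, QHM.trace c (μ + k) (ν + l) (F a) = QHM.trace c μ ν a) ∧
    -- integer shifts of `ν`: the identity map on functions
    (∀ l : ℤ, ∃ F : QHM.D c μ ν ≃⋆ₐ[ℂ] QHM.D c μ (ν + l),
      (∀ (Φ : C(QHM.Plane × ℤ, ℂ)) (hΦ : Φ ∈ QHM.D0 c ν), ∃ hΦ' : Φ ∈ QHM.D0 c (ν + l),
        F (QHM.incl c μ ν ⟨Φ, hΦ⟩) = QHM.incl c μ (ν + l) ⟨Φ, hΦ'⟩) ∧
      ∀ a, QHM.trace c μ (ν + l) (F a) = QHM.trace c μ ν a) ∧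
    -- the shift of `μ` by `1`: multiplication by the phase, implemented by a unitary
    ∃ J : QHM.D c (μ + 1) ν ≃⋆ₐ[ℂ] QHM.D c μ ν,
      (∀ (Φ : C(QHM.Plane × ℤ, ℂ)) (hΦ : Φ ∈ QHM.D0 c ν),
        ∃ (Ψ : C(QHM.Plane × ℤ, ℂ)) (hΨ : Ψ ∈ QHM.D0 c ν),
          (∀ w, Ψ w = QHM.phase c ν w * Φ w) ∧
          J (QHM.incl c (μ + 1) ν ⟨Φ, hΦ⟩) = QHM.incl c μ ν ⟨Ψ, hΨ⟩) ∧
      (∀ a, QHM.trace c μ ν (J a) = QHM.trace c (μ + 1) ν a) ∧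
      ∃ U : unitary (QHM.L2 →L[ℂ] QHM.L2),
        (∀ ξ : QHM.L2, (U : QHM.L2 →L[ℂ] QHM.L2) ξ =ᵐ[QHM.measPZ]
          fun w => QHM.phaseU c ν w * ξ w) ∧
        ∀ a : QHM.D c (μ + 1) ν,
          QHM.regRep c (μ + 1) ν a * (U : QHM.L2 →L[ℂ] QHM.L2)
            = (U : QHM.L2 →L[ℂ] QHM.L2) * QHM.regRep c μ ν (J a) := by
  refine ⟨fun k l => QHM.traceIso_add_intCast k l,
    fun l => QHM.exists_starAlgEquiv_add_intCast_right l, ?_⟩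
  obtain ⟨J, hJ, ht, hU⟩ := QHM.exists_starAlgEquiv_add_one_left (c := c) (μ := μ) (ν := ν)
  exact ⟨J, fun Φ hΦ => ⟨_, (QHM.phaseMul c ν ⟨Φ, hΦ⟩).2, fun w => rfl, hJ ⟨Φ, hΦ⟩⟩, ht,
    QHM.phaseUnitary c ν, QHM.phaseUnitary_coe, hU⟩
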